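/- Let $n\ge 6$ be an integer. Let $\mathcal H=\mathring W{}^n_2[0;1]$ be the space of (real- or complex-valued) functions $f$ on $[0,1]$ whose derivatives up to order $n-1$ exist and are absolutely continuous on $[0,1]$, with $f^{(n)}\in L_2[0;1]$ and $f^{(j)}(0)=f^{(j)}(1)=0$ for $j=0,\dots,n-1$, normed by $\|f\|_{\mathcal H}=\bigl(\int_0^1|f^{(n)}(x)|^2dx\bigr)^{1/2}$. For $a\in[0,1]$ put $$A_{n,5}(a)=\sup\{|f^{(5)}(a)| : f\in\mathcal H,\ \|f\|_{\mathcal H}\le 1\},\qquad \Lambda_{n,5}=\sup_{a\in[0,1]}A_{n,5}(a).$$ All these suprema are finite, and the following holds. 1. With $t=a^2-a$, for all $a\in[0,1]$, $$A_{n,5}^2(a)=\frac{-t^{2n-11}}{((n-3)!)^2(2n-11)}\,p_5(t),$$ where $$\begin{aligned}p_5(t)={}&16(2n-1)(2n-3)^2(2n-5)^2(2n-11)t^5+80(n-1)(n-3)(2n-3)(2n-5)^2(2n-11)t^4\\&+40(n-2)(n-3)(2n-3)(2n-5)(2n-7)(2n-11)t^3+40(n-2)(n-3)^2(n-4)(2n-5)(2n-11)t^2\\&+5(n-3)^2(n-4)^2(2n-5)(2n-11)t+(n-3)^2(n-4)^2(n-5)^2.\end{aligned}$$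 2. Let $f_{n,5}(t)=-t^{2n-11}p_5(t)$, so that $f_{n,5}(a^2-a)=A_{n,5}^2(a)\,((n-3)!)^2(2n-11)$ for $a\in[0,1]$. Then, with $t=a^2-a$, $$\frac{d}{da}f_{n,5}(a^2-a)=-t^{2n-12}(n-3)(2n-11)(2a-1)\,g_2(t)\,g_3(t),$$ where $$g_2(t)=4(2n-3)(2n-5)t^2+4(n-4)(2n-5)t+(n-4)(n-5),$$ $$g_3(t)=8(2n-1)(2n-3)(2n-5)t^3+12(n-3)(2n-3)(2n-5)t^2+6(n-3)(n-4)(2n-5)t+(n-3)(n-4)(n-5).$$ 3. Let $\varphi=\arccos\Bigl(\frac{2n-11}{2n-5}\frac{\sqrt{2n-3}}{\sqrt{5(n-3)}}\Bigr)$. Then $\cos\varphi=\frac{2n-11}{2n-5}\frac{\sqrt{2n-3}}{\sqrt{5(n-3)}}$, $\sin\varphi=\frac{2n-1}{2n-5}\frac{\sqrt{3(n-4)}}{\sqrt{5(n-3)}}$ and $\frac\pi4<\varphi<\frac\pi2$. The real roots of $g_3$ are exactly $$t_1=-\frac{n-3}{2(2n-1)}-b\cos\Bigl(\frac\varphi3-\frac\pi3\Bigr),\quad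 t_2=-\frac{n-3}{2(2n-1)}-b\cos\Bigl(\frac\varphi3+\frac\pi3\Bigr),\quad t_3=-\frac{n-3}{2(2n-1)}+b\cos\frac\varphi3,$$ where $b=\frac{\sqrt{5(n-3)}}{(2n-1)\sqrt{2n-3}}$, and $-\frac14<t_1<t_2<t_3<0$. 4. The point $t_1$ is a point of global maximum of $f_{n,5}$: $f_{n,5}(t)\le f_{n,5}(t_1)$ for all real $t$. Hence it is a point of global maximum of $A_{n,5}^2$ as a function of $t$: there are $a\in(0,1)$ with $a^2-a=t_1$, and at each such $a$ the function $A_{n,5}^2$ attains its maximum over $[0,1]$. 5. Consequently $$\Lambda_{n,5}^2=\frac{f_{n,5}(t_1)}{((n-3)!)^2(2n-11)},$$ and, with $B=2\sqrt{5(n-3)}\cos\bigl(\frac\varphi3-\frac\pi3\bigr)+(n-3)\sqrt{2n-3}$, $$\begin{aligned}f_{n,5}(t_1)=\frac1{2^{2n-11}}\Bigl(\frac{B}{(2n-1)\sqrt{2n-3}}\Bigr)^{2n-11}\Bigl[&(n-3)^2(n-4)^2(n-5)^2-\frac{5(n-3)^2(n-4)^2(2n-5)(2n-11)B}{2(2n-1)\sqrt{2n-3}}\\&+\frac{10(n-2)(n-3)^2(n-4)(2n-5)(2n-11)B^2}{(2n-1)^2(2n-3)}-\frac{5(n-2)(n-3)(2n-5)(2n-7)(2n-11)B^3}{(2n-1)^3\sqrt{2n-3}}\\&+\frac{5(n-1)(n-3)(2n-5)^2(2n-11)B^4}{(2n-1)^4(2n-3)}-\frac{(2n-5)^2(2n-11)B^5}{2(2n-1)^4\sqrt{2n-3}}\Bigr].\end{aligned}$$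 -/

import Mathlib

open Set MeasureTheory

noncomputable section

namespace SobolevEmbedding

/-- `j`-th derivative on `[0,1]` (one-sided at the end points); it only depends on `f` on `[0,1]`. -/
def der {𝕜 : Type*} [RCLike 𝕜] (j : ℕ) (f : ℝ → 𝕜) : ℝ → 𝕜 :=
  iteratedDerivWithin j f (Icc (0 : ℝ) 1)

/-- The Sobolev space `W̊ⁿ₂[0;1]`: all derivatives of order at most `n - 1` exist on `[0,1]` and are
absolutely continuous, the `n`-th derivative (which then exists almost everywhere) is in `L₂[0;1]`,
and `f⁽ʲ⁾(0) = f⁽ʲ⁾(1) = 0` for `j = 0, …, n - 1`. -/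
structure MemW {𝕜 : Type*} [RCLike 𝕜] (n : ℕ) (f : ℝ → 𝕜) : Prop where
  differentiable : ∀ j : ℕ, j + 1 < n → DifferentiableOn ℝ (der j f) (Icc (0 : ℝ) 1)
  absolutelyContinuous : ∀ j : ℕ, j < n → AbsolutelyContinuousOnInterval (der j f) 0 1
  memLp : MemLp (der n f) 2 (volume.restrict (Icc (0 : ℝ) 1))
  boundary_zero : ∀ j : ℕ, j < n → der j f 0 = 0
  boundary_one : ∀ j : ℕ, j < n → der j f 1 = 0

/-- The norm `(∫₀¹ |f⁽ⁿ⁾|²)^(1/2)` of `W̊ⁿ₂[0;1]`. -/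
def normW {𝕜 : Type*} [RCLike 𝕜] (n : ℕ) (f : ℝ → 𝕜) : ℝ :=
  Real.sqrt (∫ x in (0 : ℝ)..1, ‖der n f x‖ ^ 2)

/-- The set of the values `|f⁽ᵏ⁾(a)|` for `f` in the unit ball of `W̊ⁿ₂[0;1]`. -/
def derValues (𝕜 : Type*) [RCLike 𝕜] (n k : ℕ) (a : ℝ) : Set ℝ :=
  {r : ℝ | ∃ f : ℝ → 𝕜, MemW n f ∧ normW n f ≤ 1 ∧ r = ‖der k f a‖}

/-- `A_{n,k}(a) = sup { |f⁽ᵏ⁾(a)| : ‖f‖ ≤ 1 }`. -/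
def A (𝕜 : Type*) [RCLike 𝕜] (n k : ℕ) (a : ℝ) : ℝ :=
  sSup (derValues 𝕜 n k a)

/-- The sharp embedding constant `Λ_{n,k} = sup_{a ∈ [0,1]} A_{n,k}(a)`. -/
def Lam (𝕜 : Type*) [RCLike 𝕜] (n k : ℕ) : ℝ :=
  sSup (A 𝕜 n k '' Icc (0 : ℝ) 1)

/-- The polynomial of degree five in `t`. -/
def p5 (n t : ℝ) : ℝ :=
  16 * (2 * n - 1) * (2 * n - 3) ^ 2 * (2 * n - 5) ^ 2 * (2 * n - 11) * t ^ 5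
    + 80 * (n - 1) * (n - 3) * (2 * n - 3) * (2 * n - 5) ^ 2 * (2 * n - 11) * t ^ 4
    + 40 * (n - 2) * (n - 3) * (2 * n - 3) * (2 * n - 5) * (2 * n - 7) * (2 * n - 11) * t ^ 3
    + 40 * (n - 2) * (n - 3) ^ 2 * (n - 4) * (2 * n - 5) * (2 * n - 11) * t ^ 2
    + 5 * (n - 3) ^ 2 * (n - 4) ^ 2 * (2 * n - 5) * (2 * n - 11) * t
    + (n - 3) ^ 2 * (n - 4) ^ 2 * (n - 5) ^ 2

/-- `f_{n,5}(t) = -t^{2n-11} p₅(t)`; the exponent is meant for `n ≥ 6`. -/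
def f5 (n : ℕ) (t : ℝ) : ℝ :=
  -t ^ (2 * n - 11) * p5 n t

def g2 (n t : ℝ) : ℝ :=
  4 * (2 * n - 3) * (2 * n - 5) * t ^ 2 + 4 * (n - 4) * (2 * n - 5) * t + (n - 4) * (n - 5)

def g3 (n t : ℝ) : ℝ :=
  8 * (2 * n - 1) * (2 * n - 3) * (2 * n - 5) * t ^ 3
    + 12 * (n - 3) * (2 * n - 3) * (2 * n - 5) * t ^ 2
    + 6 * (n - 3) * (n - 4) * (2 * n - 5) * t
    + (n - 3) * (n - 4) * (n - 5)

/-- The value that `cos φ` takes. -/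
def cosPhi (n : ℝ) : ℝ :=
  (2 * n - 11) / (2 * n - 5) * (Real.sqrt (2 * n - 3) / Real.sqrt (5 * (n - 3)))

/-- The value that `sin φ` takes. -/
def sinPhi (n : ℝ) : ℝ :=
  (2 * n - 1) / (2 * n - 5) * (Real.sqrt (3 * (n - 4)) / Real.sqrt (5 * (n - 3)))

/-- The angle `φ`. -/
def phi (n : ℝ) : ℝ := Real.arccos (cosPhi n)

/-- The amplitude in the trigonometric form of the roots. -/
def amp (n : ℝ) : ℝ := Real.sqrt (5 * (n - 3)) / ((2 * n - 1) * Real.sqrt (2 * n - 3))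

def t1 (n : ℝ) : ℝ :=
  -((n - 3) / (2 * (2 * n - 1))) - amp n * Real.cos (phi n / 3 - Real.pi / 3)

def t2 (n : ℝ) : ℝ :=
  -((n - 3) / (2 * (2 * n - 1))) - amp n * Real.cos (phi n / 3 + Real.pi / 3)

def t3 (n : ℝ) : ℝ :=
  -((n - 3) / (2 * (2 * n - 1))) + amp n * Real.cos (phi n / 3)

/-- `B = 2 √(5(n-3)) cos(φ/3 - π/3) + (n-3) √(2n-3)`. -/
def bigB (n : ℝ) : ℝ :=
  2 * Real.sqrt (5 * (n - 3)) * Real.cos (phi n / 3 - Real.pi / 3) + (n - 3) * Real.sqrt (2 * n - 3)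

/-- The value of `f_{n,5}` at `t₁`, written out in terms of `B`. -/
def maxValue (n : ℕ) : ℝ :=
  let x : ℝ := n
  let B : ℝ := bigB x
  let s : ℝ := Real.sqrt (2 * x - 3)
  1 / 2 ^ (2 * n - 11) * (B / ((2 * x - 1) * s)) ^ (2 * n - 11) *
    ((x - 3) ^ 2 * (x - 4) ^ 2 * (x - 5) ^ 2
      - 5 * (x - 3) ^ 2 * (x - 4) ^ 2 * (2 * x - 5) * (2 * x - 11) * B / (2 * (2 * x - 1) * s)
      + 10 * (x - 2) * (x - 3) ^ 2 * (x - 4) * (2 * x - 5) * (2 * x - 11) * B ^ 2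
          / ((2 * x - 1) ^ 2 * (2 * x - 3))
      - 5 * (x - 2) * (x - 3) * (2 * x - 5) * (2 * x - 7) * (2 * x - 11) * B ^ 3
          / ((2 * x - 1) ^ 3 * s)
      + 5 * (x - 1) * (x - 3) * (2 * x - 5) ^ 2 * (2 * x - 11) * B ^ 4
          / ((2 * x - 1) ^ 4 * (2 * x - 3))
      - (2 * x - 5) ^ 2 * (2 * x - 11) * B ^ 5 / (2 * (2 * x - 1) ^ 4 * s))

end SobolevEmbedding

end

noncomputable section

namespace SobolevEmbedding

/-! ### Absolutely continuous functions and Taylor's formula with integral remainder. -/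

section AbsoluteContinuity

variable {X Y : Type*} [PseudoMetricSpace X] [PseudoMetricSpace Y]

/-! The problem is one of best approximation. Put k = n - 6. The conditions at 0 and Taylor's
formula give f⁽⁵⁾(a) = ∫ (a - x)₊ᵏ/k! · f⁽ⁿ⁾(x) dx, and the conditions at 1 say that f⁽ⁿ⁾ is
orthogonal to all polynomials of degree below n. By Cauchy–Schwarz, A(a) is the L₂-distance of the
truncated power from these polynomials, attained at the n-fold primitive of the normalized residual
(`isGreatest_derValues`).

In the shifted Legendre basis the squared distance is the norm of the truncated power minus a sum of
squared coefficients, each coefficient being a (k+1)-fold primitive of a Legendre polynomial.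
Differentiation in a makes the sum telescope, leaving minus the product of the k-fold primitives of
two consecutive Legendre polynomials (`hasDerivAt_sqDist`). By Rodrigues' formula these are powers
of t = a² - a times g₃ and (2a - 1)g₂, up to constants. This is the derivative of f₅(a² - a) up to
the normalizing factor, and both functions vanish at a = 0, whence the closed form
(`f5_eq_sqDist_mul`).

A shift and a scaling turn g₃ into 4y³ - 3y - cos φ, so its roots come from the triple angle formula
(`g3_shift`). The maximum rests on the identity 3(n - 3)g₂ = 3g₃ - t g₃'. To the left of t₁ it gives
g₂ ≥ 0 ≥ g₃, so f₅ increases there. Between t₁ and 0 it makes f₅ minus a suitable multiple of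
t^(2n-11) g₃² a decreasing majorant of f₅ that touches f₅ at t₁ (`antitone_sonin`). For t ≥ 0, f₅ is
nonpositive. -/

theorem absolutelyContinuousOnInterval_of_dist_le {f : ℝ → X} {g : ℝ → Y} {a b : ℝ}
    (hf : AbsolutelyContinuousOnInterval f a b)
    (h : ∀ x ∈ uIcc a b, ∀ y ∈ uIcc a b, dist (g x) (g y) ≤ dist (f x) (f y)) :
    AbsolutelyContinuousOnInterval g a b := by
  rw [absolutelyContinuousOnInterval_iff] at hf ⊢
  intro ε hε
  obtain ⟨δ, hδ, H⟩ := hf ε hε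
  refine ⟨δ, hδ, fun E hE hlt => (Finset.sum_le_sum fun i hi => ?_).trans_lt (H E hE hlt)⟩
  exact h _ (hE.1 i hi).1 _ (hE.1 i hi).2

theorem ae_differentiableAt_of_absolutelyContinuousOnInterval {𝕜 : Type*} [RCLike 𝕜]
    {f : ℝ → 𝕜} {a b : ℝ} (hf : AbsolutelyContinuousOnInterval f a b) :
    ∀ᵐ x, x ∈ uIcc a b → DifferentiableAt ℝ f x := by
  have hre : AbsolutelyContinuousOnInterval (fun x => RCLike.re (f x)) a b :=
    absolutelyContinuousOnInterval_of_dist_le hf fun x _ y _ => by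
      rw [dist_eq_norm, dist_eq_norm, ← map_sub]; exact RCLike.norm_re_le_norm _
  have him : AbsolutelyContinuousOnInterval (fun x => RCLike.im (f x)) a b :=
    absolutelyContinuousOnInterval_of_dist_le hf fun x _ y _ => by
      rw [dist_eq_norm, dist_eq_norm, ← map_sub]; exact RCLike.norm_im_le_norm _
  filter_upwards [hre.ae_differentiableAt, him.ae_differentiableAt] with x h1 h2 hx
  have h3 : DifferentiableAt ℝ (fun x => (RCLike.re (f x) : 𝕜)) x :=
    (RCLike.ofRealCLM (K := 𝕜)).differentiableAt.comp x (h1 hx)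
  have h4 : DifferentiableAt ℝ (fun x => (RCLike.im (f x) : 𝕜)) x :=
    (RCLike.ofRealCLM (K := 𝕜)).differentiableAt.comp x (h2 hx)
  have h5 := h3.fun_add (h4.mul_const (RCLike.I : 𝕜))
  simpa only [RCLike.re_add_im] using h5

/-- Taylor's formula at `0` with integral remainder for a chain of absolutely continuous
functions, each an almost everywhere derivative of the previous one and vanishing at `0`. -/
theorem eq_integral_of_chain {n : ℕ} {h : ℕ → ℝ → ℝ}
    (hac : ∀ j < n, AbsolutelyContinuousOnInterval (h j) 0 1) (h0 : ∀ j < n, h j 0 = 0)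
    (hd : ∀ j < n, ∀ᵐ x, x ∈ Icc (0 : ℝ) 1 → HasDerivAt (h j) (h (j + 1) x) x)
    {b : ℝ} (hb : b ∈ Icc (0 : ℝ) 1) (i : ℕ) : ∀ j, j + i + 1 ≤ n →
      h j b = ∫ x in (0 : ℝ)..b, (b - x) ^ i / (i.factorial : ℝ) * h (j + i + 1) x := by
  have hsub : uIcc 0 b ⊆ Icc (0 : ℝ) 1 := by
    rw [uIcc_of_le hb.1]; exact Icc_subset_Icc_right hb.2
  have hac' : ∀ j < n, AbsolutelyContinuousOnInterval (h j) 0 b := fun j hj =>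
    (hac j hj).mono (by rw [uIcc_of_le zero_le_one]; exact hsub)
  have hder : ∀ j < n, ∀ᵐ x, x ∈ uIoc 0 b → deriv (h j) x = h (j + 1) x := fun j hj => by
    filter_upwards [hd j hj] with x hx hxb
    exact (hx (hsub (uIoc_subset_uIcc hxb))).deriv
  induction i with
  | zero =>
    intro j hj
    have := (hac' j hj).integral_deriv_eq_sub
    rw [h0 j hj, sub_zero] at this
    rw [← this]
    refine intervalIntegral.integral_congr_ae ?_
    filter_upwards [hder j hj] with x hx hxb
    simp [hx hxb]
  | succ i ih =>
    intro j hj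
    rw [ih j (by omega)]
    -- Integration by parts against this primitive of the kernel: it vanishes at `b` and the chain
    -- vanishes at `0`, so no boundary terms survive.
    set u : ℝ → ℝ := fun x => (b - x) ^ (i + 1) / ((i + 1).factorial : ℝ) with hu
    have hud : ∀ x, HasDerivAt u (-((b - x) ^ i / (i.factorial : ℝ))) x := fun x => by
      have h1 := (((hasDerivAt_id x).const_sub b).pow (i + 1)).div_const ((i + 1).factorial : ℝ)
      refine h1.congr_deriv ?_
      have : (i.factorial : ℝ) ≠ 0 := by positivity
      rw [Nat.factorial_succ]
      push_cast
      simp only [id]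
      field_simp
    have huac : AbsolutelyContinuousOnInterval u 0 b := by
      refine ContDiffOn.absolutelyContinuousOnInterval ?_
      exact ContDiff.contDiffOn (by rw [hu]; fun_prop)
    have key := huac.integral_mul_deriv_eq_deriv_mul (hac' (j + i + 1) (by omega))
    rw [h0 _ (by omega)] at key
    have e1 : ∫ x in (0 : ℝ)..b, u x * deriv (h (j + i + 1)) x
        = ∫ x in (0 : ℝ)..b, u x * h (j + (i + 1) + 1) x := by
      refine intervalIntegral.integral_congr_ae ?_
      filter_upwards [hder (j + i + 1) (by omega)] with x hx hxb
      rw [hx hxb]; rfl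
    have hub : u b = 0 := by simp [hu]
    rw [← e1, key, hub]
    simp [fun x => (hud x).deriv]

end AbsoluteContinuity

/-! ### Iterated primitives. -/

section IteratedPrimitive

/-- The `k`-fold primitive of `r` vanishing at `0`. -/
def primIter : ℕ → (ℝ → ℝ) → ℝ → ℝ
  | 0, r => r
  | k + 1, r => fun x => ∫ y in (0 : ℝ)..x, primIter k r y

theorem primIter_succ (k : ℕ) (r : ℝ → ℝ) (x : ℝ) :
    primIter (k + 1) r x = ∫ y in (0 : ℝ)..x, primIter k r y := rfl

theorem primIter_succ_zero (k : ℕ) (r : ℝ → ℝ) : primIter (k + 1) r 0 = 0 := by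
  simp [primIter_succ]

variable {r : ℝ → ℝ}

theorem continuous_primIter_succ (hr : ∀ a b, IntervalIntegrable r volume a b) (k : ℕ) :
    Continuous (primIter (k + 1) r) := by
  induction k with
  | zero => exact intervalIntegral.continuous_primitive hr 0
  | succ k ih =>
    exact intervalIntegral.continuous_primitive (fun a b => ih.intervalIntegrable a b) 0

theorem intervalIntegrable_primIter (hr : ∀ a b, IntervalIntegrable r volume a b) (k : ℕ)
    (a b : ℝ) : IntervalIntegrable (primIter k r) volume a b := by
  cases k with
  | zero => exact hr a b
  | succ k => exact (continuous_primIter_succ hr k).intervalIntegrable a b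

theorem hasDerivAt_primIter_succ (hr : ∀ a b, IntervalIntegrable r volume a b) (k : ℕ) {x : ℝ}
    (hx : ContinuousAt (primIter k r) x)
    (hm : StronglyMeasurableAtFilter (primIter k r) (nhds x)) :
    HasDerivAt (primIter (k + 1) r) (primIter k r x) x :=
  intervalIntegral.integral_hasDerivAt_right (intervalIntegrable_primIter hr k _ _) hm hx

theorem hasDerivAt_primIter_succ_succ (hr : ∀ a b, IntervalIntegrable r volume a b) (k : ℕ)
    (x : ℝ) : HasDerivAt (primIter (k + 2) r) (primIter (k + 1) r x) x :=
  hasDerivAt_primIter_succ hr (k + 1) (continuous_primIter_succ hr k).continuousAt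
    ((continuous_primIter_succ hr k).stronglyMeasurableAtFilter _ _)

/-- Lebesgue differentiation; only almost everywhere because for `k = 0` the integrand `r` may jump,
as the truncated power of order 0 does. -/
theorem ae_hasDerivAt_primIter_succ (hr : ∀ a b, IntervalIntegrable r volume a b) (k : ℕ) :
    ∀ᵐ x, x ∈ Icc (0 : ℝ) 1 → HasDerivAt (primIter (k + 1) r) (primIter k r x) x := by
  filter_upwards [(intervalIntegrable_primIter hr k 0 1).ae_hasDerivAt_integral] with x hx hx1
  rw [← uIcc_of_le zero_le_one] at hx1
  exact hx hx1 0 (by simp)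

theorem absolutelyContinuousOnInterval_primIter_succ
    (hr : ∀ a b, IntervalIntegrable r volume a b) (k : ℕ) :
    AbsolutelyContinuousOnInterval (primIter (k + 1) r) 0 1 :=
  (intervalIntegrable_primIter hr k 0 1).absolutelyContinuousOnInterval_intervalIntegral (by simp)

theorem primIter_succ_eq_integral (hr : ∀ a b, IntervalIntegrable r volume a b) (k : ℕ) {b : ℝ}
    (hb : b ∈ Icc (0 : ℝ) 1) :
    primIter (k + 1) r b = ∫ x in (0 : ℝ)..b, (b - x) ^ k / (k.factorial : ℝ) * r x := by
  have := eq_integral_of_chain (n := k + 1) (h := fun j => primIter (k + 1 - j) r) ?_ ?_ ?_ hb k 0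
    (by simp)
  · simpa [primIter] using this
  · intro j hj
    obtain ⟨i, hi⟩ : ∃ i, k + 1 - j = i + 1 := ⟨k - j, by omega⟩
    simp only [hi]
    exact absolutelyContinuousOnInterval_primIter_succ hr i
  · intro j hj
    obtain ⟨i, hi⟩ : ∃ i, k + 1 - j = i + 1 := ⟨k - j, by omega⟩
    simp only [hi]
    exact primIter_succ_zero i r
  · intro j hj
    have h1 : k + 1 - j = (k - j) + 1 := by omega
    have h2 : k + 1 - (j + 1) = k - j := by omega
    simp only [h1, h2]
    exact ae_hasDerivAt_primIter_succ hr (k - j)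

end IteratedPrimitive

/-! ### Shifted Legendre polynomials from Rodrigues' formula. -/

section Legendre

open Polynomial

/-- The polynomial `(x² - x)ᵐ / m!` differentiated `j` times. -/
def rodrigues (j m : ℕ) : ℝ[X] :=
  C (1 / (m.factorial : ℝ)) * derivative^[j] ((X ^ 2 - X) ^ m)

/-- The Legendre polynomials shifted to `[0,1]`, by Rodrigues' formula. -/
def legendre (m : ℕ) : ℝ[X] := rodrigues m m

theorem derivative_rodrigues (j m : ℕ) : derivative (rodrigues j m) = rodrigues (j + 1) m := by
  simp [rodrigues, Function.iterate_succ_apply']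

theorem dvd_rodrigues {j m : ℕ} (h : j < m) : (X ^ 2 - X : ℝ[X]) ∣ rodrigues j m := by
  refine Dvd.dvd.mul_left ?_ _
  exact (dvd_pow_self _ (by omega)).trans (pow_sub_dvd_iterate_derivative_pow _ m j)

theorem eval_zero_rodrigues {j m : ℕ} (h : j < m) : (rodrigues j m).eval 0 = 0 := by
  obtain ⟨q, hq⟩ := dvd_rodrigues h
  simp [hq]

theorem eval_one_rodrigues {j m : ℕ} (h : j < m) : (rodrigues j m).eval 1 = 0 := by
  obtain ⟨q, hq⟩ := dvd_rodrigues h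
  simp [hq]

/-- With w = x² - x one has w'² = 4w + 1 and w'' = 2, so the second derivative of a power of w is
again a combination of powers of w. All later recurrences are derivatives of this one. -/
theorem rodrigues_two (m : ℕ) :
    rodrigues 2 (m + 2) = C (2 * (2 * ((m : ℝ) + 1) + 1)) * rodrigues 0 (m + 1) + rodrigues 0 m := by
  have h : C (((m + 2).factorial : ℝ)) * rodrigues 2 (m + 2)
      = C (((m + 2).factorial : ℝ)) *
        (C (2 * (2 * ((m : ℝ) + 1) + 1)) * rodrigues 0 (m + 1) + rodrigues 0 m) := by
    have e0 : C (((m + 2).factorial : ℝ)) * C (1 / ((m + 2).factorial : ℝ)) = 1 := by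
      rw [← C_mul, mul_one_div_cancel (by positivity), C_1]
    have e1 : C (((m + 2).factorial : ℝ)) * C (1 / ((m + 1).factorial : ℝ)) = C ((m : ℝ) + 2) := by
      have : ((m + 1).factorial : ℝ) ≠ 0 := by positivity
      rw [← C_mul, Nat.factorial_succ (m + 1)]
      congr 1
      push_cast
      field_simp
      ring
    have e2 : C (((m + 2).factorial : ℝ)) * C (1 / (m.factorial : ℝ))
        = C (((m : ℝ) + 2) * (m + 1)) := by
      have : (m.factorial : ℝ) ≠ 0 := by positivity
      rw [← C_mul, Nat.factorial_succ (m + 1), Nat.factorial_succ m]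
      congr 1
      push_cast
      field_simp
      ring
    have e3 : derivative^[2] ((X ^ 2 - X : ℝ[X]) ^ (m + 2))
        = C ((m : ℝ) + 2) * (C (2 * (2 * ((m : ℝ) + 1) + 1)) * (X ^ 2 - X) ^ (m + 1))
          + C (((m : ℝ) + 2) * (m + 1)) * (X ^ 2 - X) ^ m := by
      have h1 : derivative (X ^ 2 - X : ℝ[X]) = 2 * X - 1 := by
        simp [one_add_one_eq_two, show (C (2 : ℝ)) = 2 from map_ofNat C 2]
      have h2 : derivative (2 * X - 1 : ℝ[X]) = 2 := by simp
      have h3 : ∀ l : ℕ, derivative ((X ^ 2 - X : ℝ[X]) ^ (l + 1))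
          = C ((l : ℝ) + 1) * (X ^ 2 - X) ^ l * (2 * X - 1) := fun l => by
        rw [derivative_pow_succ, h1]
      rw [Function.iterate_succ_apply', Function.iterate_one, h3, derivative_mul, derivative_C_mul,
        h3, h2]
      simp only [map_add, map_mul, C_1, map_natCast, Nat.cast_add, Nat.cast_one,
        show (C (2 : ℝ)) = 2 from map_ofNat C 2]
      ring_nf
    simp only [rodrigues, mul_add]
    rw [← mul_assoc, e0, one_mul, e3]
    simp only [Function.iterate_zero, id]
    rw [← e1, ← e2]
    ring_nf
  refine mul_left_cancel₀ ?_ h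
  rw [Ne, C_eq_zero]
  positivity

theorem rodrigues_recurrence (j m : ℕ) :
    rodrigues (j + 2) (m + 2)
      = C (2 * (2 * ((m : ℝ) + 1) + 1)) * rodrigues j (m + 1) + rodrigues j m := by
  induction j with
  | zero => simpa using rodrigues_two m
  | succ j ih =>
    rw [show j + 1 + 2 = (j + 2) + 1 by ring, ← derivative_rodrigues, ih]
    simp [derivative_rodrigues]

/-- Integrated form of the classical relation between P'ₘ₊₂, P'ₘ and Pₘ₊₁: `rodrigues m (m + 1)` is
the primitive of `legendre (m + 1)` vanishing at 0. -/
theorem legendre_recurrence (m : ℕ) :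
    legendre (m + 2) = C (2 * (2 * ((m : ℝ) + 1) + 1)) * rodrigues m (m + 1) + legendre m :=
  rodrigues_recurrence m m

theorem legendre_zero : legendre 0 = 1 := by simp [legendre, rodrigues]

theorem legendre_one : legendre 1 = 2 * X - 1 := by
  simp [legendre, rodrigues, one_add_one_eq_two, show (C (2 : ℝ)) = 2 from map_ofNat C 2]

theorem eval_one_legendre (m : ℕ) : (legendre m).eval 1 = 1 := by
  induction m using Nat.twoStepInduction with
  | zero => simp [legendre_zero]
  | one => norm_num [legendre_one]
  | more m ih _ => simp [legendre_recurrence, eval_one_rodrigues, ih]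

theorem eval_zero_legendre (m : ℕ) : (legendre m).eval 0 = (-1) ^ m := by
  induction m using Nat.twoStepInduction with
  | zero => simp [legendre_zero]
  | one => norm_num [legendre_one]
  | more m ih _ => simp [legendre_recurrence, eval_zero_rodrigues, ih, pow_add]

theorem natDegree_X_sq_sub_X : (X ^ 2 - X : ℝ[X]).natDegree = 2 := by compute_degree!

theorem monic_X_sq_sub_X : (X ^ 2 - X : ℝ[X]).Monic := by monicity!

theorem natDegree_legendre_le (m : ℕ) : (legendre m).natDegree ≤ m := by
  refine (natDegree_C_mul_le _ _).trans ((natDegree_iterate_derivative _ _).trans ?_)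
  rw [monic_X_sq_sub_X.natDegree_pow, natDegree_X_sq_sub_X]
  omega

theorem coeff_legendre_ne_zero (m : ℕ) : (legendre m).coeff m ≠ 0 := by
  have h : ((X ^ 2 - X : ℝ[X]) ^ m).coeff (m + m) = 1 := by
    have := (monic_X_sq_sub_X.pow m).coeff_natDegree
    rwa [monic_X_sq_sub_X.natDegree_pow, natDegree_X_sq_sub_X, show m * 2 = m + m by ring] at this
  rw [legendre, rodrigues, coeff_C_mul, coeff_iterate_derivative, h]
  have : ((m + m).descFactorial m : ℝ) ≠ 0 := by
    exact_mod_cast (Nat.descFactorial_pos.2 (by omega)).ne'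
  simp only [nsmul_eq_mul, mul_one]
  positivity

theorem degree_legendre (m : ℕ) : (legendre m).degree = m := by
  refine le_antisymm (natDegree_le_iff_degree_le.1 (natDegree_legendre_le m)) ?_
  exact le_degree_of_ne_zero (coeff_legendre_ne_zero m)

/-- The shifted Legendre polynomials as a polynomial sequence. -/
def legendreSequence : Polynomial.Sequence ℝ where
  elems' := legendre
  degree_eq' := degree_legendre

theorem mem_span_legendre {n : ℕ} {q : ℝ[X]} (hq : q.degree < n) :
    q ∈ Submodule.span ℝ (legendre '' Set.Iio n) := by
  have := legendreSequence.span_degreeLT (m := n)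
    fun i _ => (leadingCoeff_ne_zero.2 (legendreSequence.ne_zero i)).isUnit
  rw [← mem_degreeLT, ← this] at hq
  exact hq

theorem integral_derivative_mul (p q : ℝ[X]) :
    ∫ x in (0 : ℝ)..1, (derivative p).eval x * q.eval x
      = p.eval 1 * q.eval 1 - p.eval 0 * q.eval 0
        - ∫ x in (0 : ℝ)..1, p.eval x * (derivative q).eval x := by
  have := intervalIntegral.integral_deriv_mul_eq_sub (a := 0) (b := 1)
    (u := fun x => p.eval x) (v := fun x => q.eval x)
    (fun x _ => p.hasDerivAt x) (fun x _ => q.hasDerivAt x)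
    ((derivative p).continuous.intervalIntegrable _ _)
    ((derivative q).continuous.intervalIntegrable _ _)
  rw [intervalIntegral.integral_add (f := fun x => (derivative p).eval x * q.eval x)
    (g := fun x => p.eval x * (derivative q).eval x)
    (((derivative p).continuous.mul q.continuous).intervalIntegrable _ _)
    ((p.continuous.mul (derivative q).continuous).intervalIntegrable _ _)] at this
  linarith

/-- Repeated integration by parts; the boundary terms vanish because fewer than `m` derivatives of
(x² - x)ᵐ leave a factor x² - x. -/
theorem integral_rodrigues_mul {j m : ℕ} (h : j ≤ m) (q : ℝ[X]) :
    ∫ x in (0 : ℝ)..1, (rodrigues j m).eval x * q.eval x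
      = (-1) ^ j * ∫ x in (0 : ℝ)..1, (rodrigues 0 m).eval x * (derivative^[j] q).eval x := by
  induction j generalizing q with
  | zero => simp
  | succ j ih =>
    rw [← derivative_rodrigues, integral_derivative_mul, eval_one_rodrigues (by omega),
      eval_zero_rodrigues (by omega), ih (by omega), Function.iterate_succ_apply]
    ring

theorem integral_legendre_mul_of_natDegree_lt {m : ℕ} {q : ℝ[X]} (h : q.natDegree < m) :
    ∫ x in (0 : ℝ)..1, (legendre m).eval x * q.eval x = 0 := by
  rw [legendre, integral_rodrigues_mul le_rfl, iterate_derivative_eq_zero h]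
  simp

theorem integral_legendre_mul_legendre_of_ne {m l : ℕ} (h : m ≠ l) :
    ∫ x in (0 : ℝ)..1, (legendre m).eval x * (legendre l).eval x = 0 := by
  rcases h.lt_or_gt with h | h
  · simp_rw [mul_comm ((legendre m).eval _)]
    exact integral_legendre_mul_of_natDegree_lt ((natDegree_legendre_le m).trans_lt h)
  · exact integral_legendre_mul_of_natDegree_lt ((natDegree_legendre_le l).trans_lt h)

theorem integral_legendre_mul_self (m : ℕ) :
    ∫ x in (0 : ℝ)..1, (legendre m).eval x * (legendre m).eval x = 1 / (2 * (m : ℝ) + 1) := by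
  cases m with
  | zero => simp [legendre_zero]
  | succ m =>
    have hd : ∀ l, (derivative (legendre l)).natDegree < l + 1 := fun l =>
      ((natDegree_derivative_le _).trans (Nat.sub_le _ _)).trans_lt
        (Nat.lt_succ_of_le (natDegree_legendre_le l))
    -- The boundary terms give 1 - (-1)^(2m+3) = 2. On the left, P'ₘ₊₂ is 2(2m+3)Pₘ₊₁ plus a
    -- polynomial of lower degree, orthogonal to Pₘ₊₁.
    have h1 := integral_derivative_mul (legendre (m + 2)) (legendre (m + 1))
    rw [integral_legendre_mul_of_natDegree_lt (hd (m + 1)), eval_one_legendre, eval_one_legendre,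
      eval_zero_legendre, eval_zero_legendre] at h1
    have h2 := integral_legendre_mul_of_natDegree_lt (hd m)
    have h3 : derivative (legendre (m + 2))
        = C (2 * (2 * ((m : ℝ) + 1) + 1)) * legendre (m + 1) + derivative (legendre m) := by
      rw [legendre_recurrence, derivative_add, derivative_C_mul, derivative_rodrigues]; rfl
    have h4 : ∫ x in (0 : ℝ)..1, (derivative (legendre (m + 2))).eval x * (legendre (m + 1)).eval x
        = 2 * (2 * ((m : ℝ) + 1) + 1)
            * (∫ x in (0 : ℝ)..1, (legendre (m + 1)).eval x * (legendre (m + 1)).eval x)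
          + ∫ x in (0 : ℝ)..1, (legendre (m + 1)).eval x * (derivative (legendre m)).eval x := by
      rw [← intervalIntegral.integral_const_mul, ← intervalIntegral.integral_add]
      · refine intervalIntegral.integral_congr fun x _ => ?_
        simp only [h3, eval_add, eval_mul, eval_C]
        ring
      · exact Continuous.intervalIntegrable (by fun_prop) _ _
      · exact Continuous.intervalIntegrable (by fun_prop) _ _
    have h5 : ((-1 : ℝ)) ^ (m + 2) * (-1) ^ (m + 1) = -1 := by
      rw [← pow_add, show m + 2 + (m + 1) = 2 * (m + 1) + 1 by ring, pow_succ, pow_mul]; norm_num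
    rw [h4, h2, h5] at h1
    rw [eq_div_iff (by positivity)]
    push_cast
    linarith

theorem primIter_legendre {k m : ℕ} (h : k ≤ m) :
    primIter k (fun x => (legendre m).eval x) = fun x => (rodrigues (m - k) m).eval x := by
  induction k with
  | zero => rfl
  | succ k ih =>
    funext x
    rw [primIter_succ, ih (by omega), intervalIntegral.integral_eq_sub_of_hasDerivAt
      (f := fun y => (rodrigues (m - (k + 1)) m).eval y)]
    · simp only [eval_zero_rodrigues (show m - (k + 1) < m by omega), sub_zero]
    · intro y _
      have := (rodrigues (m - (k + 1)) m).hasDerivAt y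
      rwa [derivative_rodrigues, show m - (k + 1) + 1 = m - k by omega] at this
    · exact (rodrigues (m - k) m).continuous.intervalIntegrable _ _

end Legendre

/-! ### L₂ tools on the unit interval. -/

section Interval

theorem intervalIntegral_zero_one_eq {E : Type*} [NormedAddCommGroup E] [NormedSpace ℝ E]
    (f : ℝ → E) : ∫ x in (0 : ℝ)..1, f x = ∫ x in Icc (0 : ℝ) 1, f x := by
  rw [intervalIntegral.integral_of_le zero_le_one, integral_Icc_eq_integral_Ioc]

theorem memLp_two_of_continuous {f : ℝ → ℝ} (hf : Continuous f) :
    MemLp f 2 (volume.restrict (Icc (0 : ℝ) 1)) := by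
  obtain ⟨M, hM⟩ := isCompact_Icc.exists_bound_of_continuousOn (s := Icc (0 : ℝ) 1) hf.continuousOn
  exact MemLp.of_bound hf.aestronglyMeasurable M
    ((ae_restrict_iff' measurableSet_Icc).2 (Filter.Eventually.of_forall hM))

theorem intervalIntegrable_of_memLp_two {f : ℝ → ℝ}
    (hf : MemLp f 2 (volume.restrict (Icc (0 : ℝ) 1))) : IntervalIntegrable f volume 0 1 := by
  rw [intervalIntegrable_iff_integrableOn_Icc_of_le zero_le_one]
  exact hf.integrable (by norm_num)

theorem intervalIntegrable_mul_of_memLp_two {f g : ℝ → ℝ}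
    (hf : MemLp f 2 (volume.restrict (Icc (0 : ℝ) 1)))
    (hg : MemLp g 2 (volume.restrict (Icc (0 : ℝ) 1))) :
    IntervalIntegrable (fun x => f x * g x) volume 0 1 := by
  rw [intervalIntegrable_iff_integrableOn_Icc_of_le zero_le_one]
  exact MemLp.integrable_mul hf hg

theorem integral_mul_le_sqrt_mul_sqrt {f g : ℝ → ℝ}
    (hf : MemLp f 2 (volume.restrict (Icc (0 : ℝ) 1)))
    (hg : MemLp g 2 (volume.restrict (Icc (0 : ℝ) 1))) :
    ∫ x in (0 : ℝ)..1, f x * g x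
      ≤ √(∫ x in (0 : ℝ)..1, f x ^ 2) * √(∫ x in (0 : ℝ)..1, g x ^ 2) := by
  simp only [intervalIntegral_zero_one_eq]
  have h2 : ENNReal.ofReal 2 = 2 := by norm_num
  have key := integral_mul_norm_le_Lp_mul_Lq (μ := volume.restrict (Icc (0 : ℝ) 1)) (f := f)
    (g := g) Real.HolderConjugate.two_two (by rwa [h2]) (by rwa [h2])
  simp only [Real.rpow_two, Real.norm_eq_abs, sq_abs, ← Real.sqrt_eq_rpow] at key
  refine le_trans (integral_mono (MemLp.integrable_mul hf hg) ?_ fun x => ?_) key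
  · simpa only [Pi.mul_apply, abs_mul] using (MemLp.integrable_mul hf hg).abs
  · simpa only [abs_mul] using le_abs_self (f x * g x)

open Polynomial in
theorem integral_eval_mul_eq_zero_of_mem_span {h : ℝ → ℝ} (hh : IntervalIntegrable h volume 0 1)
    {s : Set ℝ[X]} (hs : ∀ p ∈ s, ∫ x in (0 : ℝ)..1, p.eval x * h x = 0) {q : ℝ[X]}
    (hq : q ∈ Submodule.span ℝ s) : ∫ x in (0 : ℝ)..1, q.eval x * h x = 0 := by
  have hi : ∀ p : ℝ[X], IntervalIntegrable (fun x => p.eval x * h x) volume 0 1 := fun p =>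
    hh.continuousOn_mul p.continuous.continuousOn
  induction hq using Submodule.span_induction with
  | mem p hp => exact hs p hp
  | zero => simp
  | add p q _ _ hp hq =>
    simp only [eval_add, add_mul]
    rw [intervalIntegral.integral_add (hi p) (hi q), hp, hq, add_zero]
  | smul c p _ hp =>
    simp only [eval_smul, smul_eq_mul, mul_assoc]
    rw [intervalIntegral.integral_const_mul, hp, mul_zero]

open Polynomial in
/-- The powers of `1 - x` as a polynomial sequence. -/
def oneSubPowSequence : Polynomial.Sequence ℝ where
  elems' i := (1 - X) ^ i
  degree_eq' i := by
    have : (1 - X : ℝ[X]).degree = 1 := by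
      rw [← neg_sub, degree_neg]; exact degree_X_sub_C 1
    rw [degree_pow, this]; simp

open Polynomial in
theorem mem_span_one_sub_pow {n : ℕ} {q : ℝ[X]} (hq : q.degree < n) :
    q ∈ Submodule.span ℝ ((fun i => (1 - X : ℝ[X]) ^ i) '' Set.Iio n) := by
  have := oneSubPowSequence.span_degreeLT (m := n)
    fun i _ => (leadingCoeff_ne_zero.2 (oneSubPowSequence.ne_zero i)).isUnit
  rw [← mem_degreeLT, ← this] at hq
  exact hq

end Interval

/-! ### Top derivatives of functions in the Sobolev space. -/

section Sobolev

variable {𝕜 : Type*} [RCLike 𝕜]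

/-- The Taylor formula for a real functional of the derivatives of a function in `W̊ⁿ₂`. -/
theorem MemW.apply_der_eq_integral {n : ℕ} {f : ℝ → 𝕜} (hf : MemW n f) (φ : 𝕜 →L[ℝ] ℝ)
    (hφ : ∀ z, |φ z| ≤ ‖z‖) {j i : ℕ} (hji : j + i + 1 = n) {b : ℝ} (hb : b ∈ Icc (0 : ℝ) 1) :
    φ (der j f b) = ∫ x in (0 : ℝ)..b, (b - x) ^ i / (i.factorial : ℝ) * φ (der n f x) := by
  have := eq_integral_of_chain (n := n) (h := fun j x => φ (der j f x)) ?_ ?_ ?_ hb i j hji.le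
  · rwa [hji] at this
  · intro j hj
    refine absolutelyContinuousOnInterval_of_dist_le (hf.absolutelyContinuous j hj)
      fun x _ y _ => ?_
    rw [dist_eq_norm, dist_eq_norm, ← map_sub]
    exact hφ _
  · intro j hj
    simp [hf.boundary_zero j hj]
  · intro j hj
    -- The end points are discarded so that the derivative within the interval is the ordinary one.
    have h0 : ∀ᵐ x : ℝ, x ≠ 0 := by simp [ae_iff]
    have h1 : ∀ᵐ x : ℝ, x ≠ 1 := by simp [ae_iff]
    filter_upwards [ae_differentiableAt_of_absolutelyContinuousOnInterval
      (hf.absolutelyContinuous j hj), h0, h1] with x hx hx0 hx1 hxI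
    have hnhds : Icc (0 : ℝ) 1 ∈ nhds x :=
      Icc_mem_nhds (lt_of_le_of_ne hxI.1 hx0.symm) (lt_of_le_of_ne hxI.2 hx1)
    have hd := (hx (by rwa [uIcc_of_le zero_le_one])).hasDerivAt
    have he : der (j + 1) f x = deriv (der j f) x := by
      rw [der, iteratedDerivWithin_succ, derivWithin_of_mem_nhds hnhds]; rfl
    rw [he]
    exact φ.hasFDerivAt.comp_hasDerivAt x hd

theorem MemW.memLp_apply_der {n : ℕ} {f : ℝ → 𝕜} (hf : MemW n f) (φ : 𝕜 →L[ℝ] ℝ) :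
    MemLp (fun x => φ (der n f x)) 2 (volume.restrict (Icc (0 : ℝ) 1)) :=
  φ.comp_memLp' hf.memLp

open Polynomial in
/-- The top derivative of a function in `W̊ⁿ₂` is orthogonal to polynomials of degree `< n`. -/
theorem MemW.integral_eval_mul_apply_der {n : ℕ} {f : ℝ → 𝕜} (hf : MemW n f) (φ : 𝕜 →L[ℝ] ℝ)
    (hφ : ∀ z, |φ z| ≤ ‖z‖) {q : ℝ[X]} (hq : q.degree < n) :
    ∫ x in (0 : ℝ)..1, q.eval x * φ (der n f x) = 0 := by
  refine integral_eval_mul_eq_zero_of_mem_span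
    (intervalIntegrable_of_memLp_two (hf.memLp_apply_der φ)) ?_ (mem_span_one_sub_pow hq)
  rintro _ ⟨i, hi, rfl⟩
  have hi' : i < n := hi
  -- Taylor's formula at the point 1 has kernel (1 - x)ⁱ/i!, so each vanishing derivative at 1 is
  -- one orthogonality relation. This is why the basis of powers of 1 - x is used.
  have := hf.apply_der_eq_integral φ hφ (j := n - 1 - i) (i := i) (by omega)
    (right_mem_Icc.2 zero_le_one)
  rw [hf.boundary_one _ (by omega), map_zero] at this
  have h2 : ∫ x in (0 : ℝ)..1, (1 - x) ^ i / (i.factorial : ℝ) * φ (der n f x)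
      = (1 / (i.factorial : ℝ)) * ∫ x in (0 : ℝ)..1, (1 - x) ^ i * φ (der n f x) := by
    rw [← intervalIntegral.integral_const_mul]
    exact intervalIntegral.integral_congr fun x _ => by ring
  rw [h2] at this
  have h3 : (1 / (i.factorial : ℝ)) ≠ 0 := by positivity
  simpa using (mul_eq_zero.1 this.symm).resolve_left h3

theorem hasDerivAt_ofReal_comp {f : ℝ → ℝ} {f' x : ℝ} (hf : HasDerivAt f f' x) :
    HasDerivAt (fun y => (f y : 𝕜)) (f' : 𝕜) x :=
  (RCLike.ofRealCLM (K := 𝕜)).hasFDerivAt.comp_hasDerivAt x hf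

variable {n : ℕ} {r : ℝ → ℝ}

theorem der_primIter (hr : ∀ a b, IntervalIntegrable r volume a b) :
    ∀ j < n, ∀ x ∈ Icc (0 : ℝ) 1,
      der j (fun x => (primIter n r x : 𝕜)) x = (primIter (n - j) r x : 𝕜) := by
  intro j
  induction j with
  | zero => intro _ x _; simp [der]
  | succ j ih =>
    intro hj x hx
    obtain ⟨l, hl⟩ : ∃ l, n - (j + 1) = l + 1 := ⟨n - (j + 1) - 1, by omega⟩
    have h1 : HasDerivWithinAt (der j (fun x => (primIter n r x : 𝕜)))
        (primIter (n - (j + 1)) r x : 𝕜) (Icc 0 1) x := by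
      have h2 := hasDerivAt_ofReal_comp (𝕜 := 𝕜) (hasDerivAt_primIter_succ_succ hr l x)
      rw [hl]
      refine h2.hasDerivWithinAt.congr (fun y hy => ?_) ?_
      · rw [ih (by omega) y hy, show n - j = l + 2 by omega]
      · rw [ih (by omega) x hx, show n - j = l + 2 by omega]
    rw [der, iteratedDerivWithin_succ]
    exact h1.derivWithin (uniqueDiffOn_Icc zero_lt_one x hx)

theorem der_primIter_self (hn : 0 < n) (hr : ∀ a b, IntervalIntegrable r volume a b) :
    ∀ᵐ x ∂volume.restrict (Icc (0 : ℝ) 1),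
      der n (fun x => (primIter n r x : 𝕜)) x = (r x : 𝕜) := by
  rw [ae_restrict_iff' measurableSet_Icc]
  filter_upwards [ae_hasDerivAt_primIter_succ hr 0] with x hx hxI
  obtain ⟨l, rfl⟩ : ∃ l, n = l + 1 := ⟨n - 1, by omega⟩
  have h1 : HasDerivWithinAt (der l (fun x => (primIter (l + 1) r x : 𝕜))) (r x : 𝕜)
      (Icc 0 1) x := by
    have h2 := hasDerivAt_ofReal_comp (𝕜 := 𝕜) (hx hxI)
    refine h2.hasDerivWithinAt.congr (fun y hy => ?_) ?_
    · rw [der_primIter hr l (by omega) y hy, show l + 1 - l = 0 + 1 by omega]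
    · rw [der_primIter hr l (by omega) x hxI, show l + 1 - l = 0 + 1 by omega]
  rw [der, iteratedDerivWithin_succ]
  exact h1.derivWithin (uniqueDiffOn_Icc zero_lt_one x hxI)

/-- Converse of the orthogonality of top derivatives: the primitives vanish at 0 by construction,
and at 1 because Taylor's formula turns their values there into moments of `r`. It supplies the
extremal functions. -/
theorem memW_primIter (hn : 0 < n) (hr : ∀ a b, IntervalIntegrable r volume a b)
    (hr2 : MemLp r 2 (volume.restrict (Icc (0 : ℝ) 1)))
    (horth : ∀ i < n, ∫ x in (0 : ℝ)..1, (1 - x) ^ i * r x = 0) :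
    MemW n (fun x => (primIter n r x : 𝕜)) where
  differentiable j hj := by
    intro x hx
    obtain ⟨l, hl⟩ : ∃ l, n - j = l + 2 := ⟨n - j - 2, by omega⟩
    have h2 := hasDerivAt_ofReal_comp (𝕜 := 𝕜) (hasDerivAt_primIter_succ_succ hr l x)
    refine (h2.hasDerivWithinAt.congr (fun y hy => ?_) ?_).differentiableWithinAt
    · rw [der_primIter hr j (by omega) y hy, hl]
    · rw [der_primIter hr j (by omega) x hx, hl]
  absolutelyContinuous j hj := by
    obtain ⟨l, hl⟩ : ∃ l, n - j = l + 1 := ⟨n - j - 1, by omega⟩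
    refine absolutelyContinuousOnInterval_of_dist_le
      (absolutelyContinuousOnInterval_primIter_succ hr l) fun x hx y hy => ?_
    rw [uIcc_of_le zero_le_one] at hx hy
    rw [der_primIter hr j hj x hx, der_primIter hr j hj y hy, hl, dist_eq_norm, dist_eq_norm,
      ← RCLike.ofReal_sub, RCLike.norm_ofReal, Real.norm_eq_abs]
  memLp := by
    refine (memLp_congr_ae ?_).2 (hr2.ofReal (K := 𝕜))
    exact der_primIter_self hn hr
  boundary_zero j hj := by
    obtain ⟨l, hl⟩ : ∃ l, n - j = l + 1 := ⟨n - j - 1, by omega⟩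
    rw [der_primIter hr j hj 0 (by simp), hl, primIter_succ_zero, RCLike.ofReal_zero]
  boundary_one j hj := by
    obtain ⟨l, hl⟩ : ∃ l, n - j = l + 1 := ⟨n - j - 1, by omega⟩
    rw [der_primIter hr j hj 1 (by simp), hl, primIter_succ_eq_integral hr l (by simp)]
    have h2 : ∫ x in (0 : ℝ)..1, (1 - x) ^ l / (l.factorial : ℝ) * r x
        = (1 / (l.factorial : ℝ)) * ∫ x in (0 : ℝ)..1, (1 - x) ^ l * r x := by
      rw [← intervalIntegral.integral_const_mul]
      exact intervalIntegral.integral_congr fun x _ => by ring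
    rw [h2, horth l (by omega), mul_zero, RCLike.ofReal_zero]

theorem normW_primIter (hn : 0 < n) (hr : ∀ a b, IntervalIntegrable r volume a b) :
    normW n (fun x => (primIter n r x : 𝕜)) = √(∫ x in (0 : ℝ)..1, r x ^ 2) := by
  rw [normW, intervalIntegral_zero_one_eq, intervalIntegral_zero_one_eq]
  congr 1
  refine integral_congr_ae ?_
  filter_upwards [der_primIter_self (𝕜 := 𝕜) hn hr] with x hx
  simp only [hx, RCLike.norm_ofReal, sq_abs]

end Sobolev

/-! ### The extremal problem as a distance to polynomials. -/

section Residual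

open Polynomial

/-- The truncated power `(a - x)₊ᵏ / k!`. -/
def truncPow (k : ℕ) (a : ℝ) : ℝ → ℝ :=
  indicator {x | x ≤ a} fun x => (a - x) ^ k / (k.factorial : ℝ)

/-- The integral of `legendre m` against `truncPow k a`, as a function of `a`. -/
def legendreCoeff (k m : ℕ) : ℝ → ℝ := primIter (k + 1) fun x => (legendre m).eval x

/-- The `L₂`-projection of `truncPow k a` to the polynomials of degree less than `n`. -/
def projPoly (k n : ℕ) (a : ℝ) : ℝ[X] :=
  ∑ m ∈ Finset.range n, C ((2 * (m : ℝ) + 1) * legendreCoeff k m a) * legendre m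

/-- The component of `truncPow k a` orthogonal to the polynomials of degree less than `n`. -/
def residual (k n : ℕ) (a x : ℝ) : ℝ := truncPow k a x - (projPoly k n a).eval x

/-- The squared `L₂`-distance of `truncPow k a` from the polynomials of degree less than `n`. -/
def sqDist (k n : ℕ) (a : ℝ) : ℝ :=
  a ^ (2 * k + 1) / ((2 * (k : ℝ) + 1) * (k.factorial : ℝ) ^ 2)
    - ∑ m ∈ Finset.range n, (2 * (m : ℝ) + 1) * legendreCoeff k m a ^ 2

variable {k n : ℕ} {a : ℝ}

theorem memLp_truncPow : MemLp (truncPow k a) 2 (volume.restrict (Icc (0 : ℝ) 1)) :=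
  (memLp_two_of_continuous (by fun_prop)).indicator measurableSet_Iic

theorem memLp_residual : MemLp (residual k n a) 2 (volume.restrict (Icc (0 : ℝ) 1)) :=
  memLp_truncPow.sub (memLp_two_of_continuous (projPoly k n a).continuous)

theorem intervalIntegrable_residual (b c : ℝ) :
    IntervalIntegrable (residual k n a) volume b c := by
  refine IntervalIntegrable.sub ?_ ((projPoly k n a).continuous.intervalIntegrable b c)
  have h : IntervalIntegrable (fun x => (a - x) ^ k / (k.factorial : ℝ)) volume b c :=
    Continuous.intervalIntegrable (by fun_prop) b c
  exact ⟨h.1.indicator measurableSet_Iic, h.2.indicator measurableSet_Iic⟩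

theorem integral_truncPow_mul (ha : a ∈ Icc (0 : ℝ) 1) (g : ℝ → ℝ) :
    ∫ x in (0 : ℝ)..1, truncPow k a x * g x
      = ∫ x in (0 : ℝ)..a, (a - x) ^ k / (k.factorial : ℝ) * g x := by
  rw [← intervalIntegral.integral_indicator (f := fun x => (a - x) ^ k / (k.factorial : ℝ) * g x)
    ha]
  refine intervalIntegral.integral_congr fun x _ => ?_
  by_cases hx : x ≤ a <;> simp [truncPow, indicator, hx]

theorem integral_truncPow_mul_legendre (ha : a ∈ Icc (0 : ℝ) 1) (m : ℕ) :
    ∫ x in (0 : ℝ)..1, truncPow k a x * (legendre m).eval x = legendreCoeff k m a := by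
  rw [integral_truncPow_mul ha, legendreCoeff, primIter_succ_eq_integral _ k ha]
  exact fun b c => (legendre m).continuous.intervalIntegrable b c

theorem integral_truncPow_sq (ha : a ∈ Icc (0 : ℝ) 1) :
    ∫ x in (0 : ℝ)..1, truncPow k a x * truncPow k a x
      = a ^ (2 * k + 1) / ((2 * (k : ℝ) + 1) * (k.factorial : ℝ) ^ 2) := by
  rw [integral_truncPow_mul ha]
  have h : ∫ x in (0 : ℝ)..a, (a - x) ^ k / (k.factorial : ℝ) * truncPow k a x
      = ∫ x in (0 : ℝ)..a, (a - x) ^ (2 * k) / (k.factorial : ℝ) ^ 2 := by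
    refine intervalIntegral.integral_congr fun x hx => ?_
    rw [uIcc_of_le ha.1] at hx
    have : truncPow k a x = (a - x) ^ k / (k.factorial : ℝ) :=
      indicator_of_mem (show x ∈ {x | x ≤ a} from hx.2) _
    simp only [this]
    ring
  rw [h, intervalIntegral.integral_comp_sub_left (fun y => y ^ (2 * k) / (k.factorial : ℝ) ^ 2) a,
    intervalIntegral.integral_div, integral_pow]
  simp [div_div]

theorem integral_projPoly_mul {g : ℝ → ℝ}
    (hg : MemLp g 2 (volume.restrict (Icc (0 : ℝ) 1))) :
    ∫ x in (0 : ℝ)..1, (projPoly k n a).eval x * g x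
      = ∑ m ∈ Finset.range n, (2 * (m : ℝ) + 1) * legendreCoeff k m a
          * ∫ x in (0 : ℝ)..1, (legendre m).eval x * g x := by
  simp only [projPoly, eval_finsetSum, eval_mul, eval_C, Finset.sum_mul, mul_assoc]
  rw [intervalIntegral.integral_finsetSum]
  · simp only [intervalIntegral.integral_const_mul]
  · intro m _
    exact ((intervalIntegrable_mul_of_memLp_two
      (memLp_two_of_continuous (legendre m).continuous) hg).const_mul _).const_mul _

theorem integral_residual_mul {g : ℝ → ℝ}
    (hg : MemLp g 2 (volume.restrict (Icc (0 : ℝ) 1))) :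
    ∫ x in (0 : ℝ)..1, residual k n a x * g x
      = (∫ x in (0 : ℝ)..1, truncPow k a x * g x)
        - ∫ x in (0 : ℝ)..1, (projPoly k n a).eval x * g x := by
  rw [← intervalIntegral.integral_sub (intervalIntegrable_mul_of_memLp_two memLp_truncPow hg)
    (intervalIntegrable_mul_of_memLp_two
      (memLp_two_of_continuous (projPoly k n a).continuous) hg)]
  exact intervalIntegral.integral_congr fun x _ => sub_mul _ _ _

theorem integral_legendre_mul_residual (ha : a ∈ Icc (0 : ℝ) 1) {l : ℕ} (hl : l < n) :
    ∫ x in (0 : ℝ)..1, (legendre l).eval x * residual k n a x = 0 := by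
  simp_rw [mul_comm ((legendre l).eval _)]
  have hg := memLp_two_of_continuous (legendre l).continuous
  rw [integral_residual_mul hg, integral_truncPow_mul_legendre ha, integral_projPoly_mul hg,
    Finset.sum_eq_single l]
  · rw [integral_legendre_mul_self]
    have : 2 * (l : ℝ) + 1 ≠ 0 := by positivity
    field_simp
    ring
  · intro m _ hm
    rw [integral_legendre_mul_legendre_of_ne hm, mul_zero]
  · intro h
    exact absurd (Finset.mem_range.2 hl) h

theorem integral_eval_mul_residual (ha : a ∈ Icc (0 : ℝ) 1) {q : ℝ[X]} (hq : q.degree < n) :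
    ∫ x in (0 : ℝ)..1, q.eval x * residual k n a x = 0 := by
  refine integral_eval_mul_eq_zero_of_mem_span (intervalIntegrable_residual 0 1) ?_
    (mem_span_legendre hq)
  rintro _ ⟨l, hl, rfl⟩
  exact integral_legendre_mul_residual ha hl

theorem degree_projPoly_lt : (projPoly k n a).degree < n := by
  rw [← mem_degreeLT]
  refine Submodule.sum_mem _ fun m hm => ?_
  rw [← smul_eq_C_mul]
  refine Submodule.smul_mem _ _ ?_
  rw [mem_degreeLT, degree_legendre]
  exact_mod_cast Finset.mem_range.1 hm

theorem integral_truncPow_mul_residual (ha : a ∈ Icc (0 : ℝ) 1) :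
    ∫ x in (0 : ℝ)..1, truncPow k a x * residual k n a x = sqDist k n a := by
  simp_rw [mul_comm (truncPow k a _)]
  rw [integral_residual_mul memLp_truncPow, integral_truncPow_sq ha,
    integral_projPoly_mul memLp_truncPow, sqDist]
  congr 1
  refine Finset.sum_congr rfl fun m _ => ?_
  simp_rw [mul_comm ((legendre m).eval _)]
  rw [integral_truncPow_mul_legendre ha]
  ring

/-- The residual is orthogonal to the projection, so pairing it with itself equals pairing it with
the truncated power. -/
theorem integral_residual_sq (ha : a ∈ Icc (0 : ℝ) 1) :
    ∫ x in (0 : ℝ)..1, residual k n a x ^ 2 = sqDist k n a := by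
  simp only [pow_two]
  rw [integral_residual_mul memLp_residual, integral_truncPow_mul_residual ha,
    integral_eval_mul_residual ha degree_projPoly_lt, sub_zero]

theorem sqDist_nonneg (ha : a ∈ Icc (0 : ℝ) 1) : 0 ≤ sqDist k n a := by
  rw [← integral_residual_sq ha]
  exact intervalIntegral.integral_nonneg zero_le_one fun x _ => sq_nonneg _

variable {𝕜 : Type*} [RCLike 𝕜]

theorem MemW.norm_der_le {f : ℝ → 𝕜} (hf : MemW n f) {j : ℕ} (hjk : j + k + 1 = n)
    (ha : a ∈ Icc (0 : ℝ) 1) : ‖der j f a‖ ≤ √(sqDist k n a) * normW n f := by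
  -- A unimodular rotation makes the value real and nonnegative; the real part after rotation is a
  -- contraction, so the scalar theory applies.
  obtain ⟨c, hc, hcz⟩ := RCLike.exists_norm_eq_mul_self (der j f a)
  set φ : 𝕜 →L[ℝ] ℝ := (RCLike.reCLM (K := 𝕜)).comp (ContinuousLinearMap.mul ℝ 𝕜 c) with hφdef
  have hφ : ∀ z, |φ z| ≤ ‖z‖ := fun z => by
    have : φ z = RCLike.re (c * z) := rfl
    rw [this]
    refine (RCLike.abs_re_le_norm _).trans ?_
    rw [norm_mul, hc, one_mul]
  have h1 : φ (der j f a) = ‖der j f a‖ := by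
    have : φ (der j f a) = RCLike.re (c * der j f a) := rfl
    rw [this, ← hcz, RCLike.ofReal_re]
  have hg := hf.memLp_apply_der φ
  have h2 : ‖der j f a‖ = ∫ x in (0 : ℝ)..1, residual k n a x * φ (der n f x) := by
    rw [integral_residual_mul hg, integral_truncPow_mul ha,
      hf.integral_eval_mul_apply_der φ hφ degree_projPoly_lt, sub_zero, ← h1]
    exact hf.apply_der_eq_integral φ hφ hjk ha
  rw [h2]
  refine (integral_mul_le_sqrt_mul_sqrt memLp_residual hg).trans ?_
  rw [integral_residual_sq ha, normW]
  refine mul_le_mul_of_nonneg_left (Real.sqrt_le_sqrt ?_) (Real.sqrt_nonneg _)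
  rw [intervalIntegral_zero_one_eq, intervalIntegral_zero_one_eq]
  have hint : Integrable (fun x => ‖der n f x‖ ^ 2) (volume.restrict (Icc (0 : ℝ) 1)) :=
    hf.memLp.norm.integrable_sq
  refine integral_mono hg.integrable_sq hint fun x => ?_
  simp only
  rw [← sq_abs]
  exact pow_le_pow_left₀ (abs_nonneg _) (hφ _) 2

/-- The supremum of `|f⁽ʲ⁾(a)|` over the unit ball is attained and equals the `L₂`-distance of the
truncated power `(a - x)₊ᵏ / k!`, `k = n - 1 - j`, from the polynomials of degree less than `n`. -/
theorem isGreatest_derValues {j : ℕ} (hjk : j + k + 1 = n) (ha : a ∈ Icc (0 : ℝ) 1) :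
    IsGreatest (derValues 𝕜 n j a) √(sqDist k n a) := by
  have hS := sqDist_nonneg (k := k) (n := n) ha
  constructor
  -- If the distance is zero (as at `a = 0`), division by zero gives `c = 0`; the extremal function
  -- is then zero and the computation below still holds.
  · set c : ℝ := 1 / √(sqDist k n a) with hc
    set r : ℝ → ℝ := fun x => c * residual k n a x with hrdef
    have hn : 0 < n := by omega
    have hr : ∀ b d, IntervalIntegrable r volume b d := fun b d =>
      (intervalIntegrable_residual b d).const_mul c
    have hr2 : MemLp r 2 (volume.restrict (Icc (0 : ℝ) 1)) := memLp_residual.const_mul c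
    have horth : ∀ i < n, ∫ x in (0 : ℝ)..1, (1 - x) ^ i * r x = 0 := fun i hi => by
      have h1 := integral_eval_mul_residual (k := k) ha (q := (1 - X) ^ i) (n := n) (by
        have := oneSubPowSequence.degree_eq i
        rw [show oneSubPowSequence i = (1 - X) ^ i from rfl] at this
        rw [this]; exact_mod_cast hi)
      simp only [eval_pow, eval_sub, eval_one, eval_X] at h1
      simp only [hrdef, mul_left_comm _ c]
      rw [intervalIntegral.integral_const_mul, h1, mul_zero]
    refine ⟨fun x => (primIter n r x : 𝕜), memW_primIter hn hr hr2 horth, ?_, ?_⟩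
    · rw [normW_primIter hn hr, Real.sqrt_le_one]
      simp only [hrdef, mul_pow]
      rw [intervalIntegral.integral_const_mul, integral_residual_sq ha, hc, div_pow, one_pow,
        Real.sq_sqrt hS, one_div]
      exact inv_mul_le_one
    · rw [der_primIter hr j (by omega) a ha, RCLike.norm_ofReal, show n - j = k + 1 by omega,
        primIter_succ_eq_integral hr k ha, ← integral_truncPow_mul ha]
      simp only [hrdef, mul_left_comm _ c]
      rw [intervalIntegral.integral_const_mul, integral_truncPow_mul_residual ha, hc,
        one_div_mul_eq_div, Real.div_sqrt, abs_of_nonneg (Real.sqrt_nonneg _)]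
  · rintro _ ⟨f, hf, hf1, rfl⟩
    exact (hf.norm_der_le hjk ha).trans (mul_le_of_le_one_right (Real.sqrt_nonneg _) hf1)

theorem A_eq_sqrt_sqDist {j : ℕ} (hjk : j + k + 1 = n) (ha : a ∈ Icc (0 : ℝ) 1) :
    A 𝕜 n j a = √(sqDist k n a) :=
  (isGreatest_derValues hjk ha).csSup_eq

end Residual

/-! ### Differentiation of the squared distance and its closed form. -/

section ClosedForm

open Polynomial

theorem primIter_linear {f g : ℝ → ℝ} (hf : Continuous f) (hg : Continuous g) (c d : ℝ) (k : ℕ)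
    (x : ℝ) : primIter k (fun x => c * f x + d * g x) x
      = c * primIter k f x + d * primIter k g x := by
  induction k generalizing x with
  | zero => rfl
  | succ k ih =>
    simp only [primIter_succ, ih]
    have hf' := intervalIntegrable_primIter (fun a b => hf.intervalIntegrable a b) k 0 x
    have hg' := intervalIntegrable_primIter (fun a b => hg.intervalIntegrable a b) k 0 x
    rw [intervalIntegral.integral_add (hf'.const_mul c) (hg'.const_mul d),
      intervalIntegral.integral_const_mul, intervalIntegral.integral_const_mul]

theorem primIter_succ' (k : ℕ) (f : ℝ → ℝ) : primIter (k + 1) f = primIter k (primIter 1 f) := by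
  induction k with
  | zero => rfl
  | succ k ih =>
    funext x
    rw [primIter_succ, ih, ← primIter_succ]

theorem primIter_one_const (k : ℕ) (x : ℝ) :
    primIter k (fun _ => 1) x = x ^ k / (k.factorial : ℝ) := by
  induction k generalizing x with
  | zero => simp [primIter]
  | succ k ih =>
    simp only [primIter_succ, ih]
    have : (k.factorial : ℝ) ≠ 0 := by positivity
    rw [intervalIntegral.integral_div, integral_pow, Nat.factorial_succ]
    push_cast
    field_simp
    simp

/-- The derivative of `legendreCoeff k m`. -/
def legendreCoeffDeriv (k m : ℕ) : ℝ → ℝ := primIter k fun x => (legendre m).eval x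

theorem hasDerivAt_legendreCoeff (k m : ℕ) (a : ℝ) :
    HasDerivAt (legendreCoeff k m) (legendreCoeffDeriv k m a) a := by
  have hr : ∀ b c, IntervalIntegrable (fun x => (legendre m).eval x) volume b c := fun b c =>
    (legendre m).continuous.intervalIntegrable b c
  have hc : Continuous (primIter k fun x => (legendre m).eval x) := by
    cases k with
    | zero => exact (legendre m).continuous
    | succ k => exact continuous_primIter_succ hr k
  exact hasDerivAt_primIter_succ hr k hc.continuousAt (hc.stronglyMeasurableAtFilter _ _)

theorem legendreCoeff_zero_eq (k : ℕ) (a : ℝ) :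
    2 * legendreCoeff k 0 a = legendreCoeffDeriv k 1 a + legendreCoeffDeriv k 0 a := by
  have h1 : (fun x => (legendre 1).eval x)
      = fun x => 2 * primIter 1 (fun x => (legendre 0).eval x) x
        + (-1) * (legendre 0).eval x := by
    funext x
    simp [legendre_one, legendre_zero, primIter, sub_eq_add_neg]
  have hc : Continuous (primIter 1 fun x => (legendre 0).eval x) :=
    continuous_primIter_succ (fun b c => (legendre 0).continuous.intervalIntegrable b c) 0
  rw [legendreCoeff, legendreCoeffDeriv, legendreCoeffDeriv, h1,
    primIter_linear hc (legendre 0).continuous, primIter_succ']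
  ring

theorem legendreCoeff_succ_eq (k m : ℕ) (a : ℝ) :
    2 * (2 * ((m : ℝ) + 1) + 1) * legendreCoeff k (m + 1) a
      = legendreCoeffDeriv k (m + 2) a - legendreCoeffDeriv k m a := by
  have h1 : (fun x => (legendre (m + 2)).eval x)
      = fun x => 2 * (2 * ((m : ℝ) + 1) + 1)
          * primIter 1 (fun x => (legendre (m + 1)).eval x) x + 1 * (legendre m).eval x := by
    funext x
    rw [primIter_legendre (by omega), legendre_recurrence]
    simp
  have hc : Continuous (primIter 1 fun x => (legendre (m + 1)).eval x) :=
    continuous_primIter_succ (fun b c => (legendre (m + 1)).continuous.intervalIntegrable b c) 0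
  rw [legendreCoeff, legendreCoeffDeriv, legendreCoeffDeriv, h1,
    primIter_linear hc (legendre m).continuous, primIter_succ']
  ring

/-- A Christoffel–Darboux type summation. -/
theorem sum_legendreCoeff_mul_deriv (k n : ℕ) (a : ℝ) :
    ∑ m ∈ Finset.range (n + 1),
        (2 * (m : ℝ) + 1) * (2 * legendreCoeff k m a * legendreCoeffDeriv k m a)
      = legendreCoeffDeriv k 0 a ^ 2 + legendreCoeffDeriv k (n + 1) a * legendreCoeffDeriv k n a := by
  induction n with
  | zero =>
    have := legendreCoeff_zero_eq k a
    simp only [zero_add, Finset.range_one, Finset.sum_singleton, this]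
    push_cast
    ring
  | succ n ih =>
    -- With dₘ the derivative of the m-th coefficient cₘ, the relation 2(2m+1)cₘ = dₘ₊₁ - dₘ₋₁ makes
    -- each summand dₘdₘ₊₁ - dₘ₋₁dₘ, and the sum telescopes.
    rw [Finset.sum_range_succ, ih]
    have := legendreCoeff_succ_eq k n a
    push_cast
    linear_combination legendreCoeffDeriv k (n + 1) a * this

/-- The term d₀² left by the telescoping is (aᵏ/k!)², which cancels the derivative of the norm of
the truncated power. -/
theorem hasDerivAt_sqDist (k n : ℕ) (a : ℝ) :
    HasDerivAt (sqDist k (n + 1))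
      (-(legendreCoeffDeriv k (n + 1) a * legendreCoeffDeriv k n a)) a := by
  have h1 := (hasDerivAt_pow (2 * k + 1) a).div_const
    ((2 * (k : ℝ) + 1) * (k.factorial : ℝ) ^ 2)
  have h2 := HasDerivAt.fun_sum (u := Finset.range (n + 1)) fun m _ =>
    ((hasDerivAt_legendreCoeff k m a).fun_pow 2).const_mul (2 * (m : ℝ) + 1)
  refine (h1.sub h2).congr_deriv ?_
  have h3 := sum_legendreCoeff_mul_deriv k n a
  have h4 : legendreCoeffDeriv k 0 a = a ^ k / (k.factorial : ℝ) := by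
    rw [← primIter_one_const]; simp [legendreCoeffDeriv, legendre_zero]
  have h5 : (k.factorial : ℝ) ≠ 0 := by positivity
  have h6 : (2 * (k : ℝ) + 1) ≠ 0 := by positivity
  simp only [Nat.add_sub_cancel, pow_one, Nat.cast_ofNat, show 2 - 1 = 1 from rfl]
  rw [h3, h4]
  push_cast
  field_simp
  ring

theorem sqDist_zero (k n : ℕ) : sqDist k n 0 = 0 := by
  simp [sqDist, legendreCoeff, primIter_succ_zero]

theorem eval_rodrigues_zero (m : ℕ) (x : ℝ) :
    (rodrigues 0 m).eval x = (x ^ 2 - x) ^ m / (m.factorial : ℝ) := by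
  simp [rodrigues]; ring

theorem eval_rodrigues_one (m : ℕ) (x : ℝ) :
    (rodrigues 1 (m + 1)).eval x = (x ^ 2 - x) ^ m * (2 * x - 1) / (m.factorial : ℝ) := by
  have h : ((m.factorial : ℕ) : ℝ) ≠ 0 := by positivity
  simp [rodrigues, derivative_pow_succ, Nat.factorial_succ]
  field_simp
  ring

theorem eval_rodrigues_recurrence (j m : ℕ) (x : ℝ) :
    (rodrigues (j + 2) (m + 2)).eval x
      = 2 * (2 * ((m : ℝ) + 1) + 1) * (rodrigues j (m + 1)).eval x + (rodrigues j m).eval x := by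
  rw [rodrigues_recurrence]; simp

/-- The recurrence lowers both indices until only first derivatives of powers of x² - x remain; this
is the origin of `g2`, as the next lemma is that of `g3`. -/
theorem eval_rodrigues_five (k : ℕ) (x : ℝ) :
    (rodrigues 5 (k + 5)).eval x
      = (x ^ 2 - x) ^ k * (2 * x - 1) * g2 ((k : ℝ) + 6) (x ^ 2 - x)
        / ((k + 2).factorial : ℝ) := by
  have h : (k.factorial : ℝ) ≠ 0 := by positivity
  rw [eval_rodrigues_recurrence 3 (k + 3), eval_rodrigues_recurrence 1 (k + 2),
    eval_rodrigues_recurrence 1 (k + 1), eval_rodrigues_one, eval_rodrigues_one,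
    eval_rodrigues_one, g2]
  simp only [Nat.factorial_succ]
  generalize x ^ 2 - x = t
  push_cast
  field_simp
  ring

theorem eval_rodrigues_six (k : ℕ) (x : ℝ) :
    (rodrigues 6 (k + 6)).eval x
      = (x ^ 2 - x) ^ k * g3 ((k : ℝ) + 6) (x ^ 2 - x) / ((k + 3).factorial : ℝ) := by
  have h : (k.factorial : ℝ) ≠ 0 := by positivity
  rw [eval_rodrigues_recurrence 4 (k + 4), eval_rodrigues_recurrence 2 (k + 3),
    eval_rodrigues_recurrence 2 (k + 2), eval_rodrigues_recurrence 0 (k + 2),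
    eval_rodrigues_recurrence 0 (k + 1), eval_rodrigues_recurrence 0 k, eval_rodrigues_zero,
    eval_rodrigues_zero, eval_rodrigues_zero, eval_rodrigues_zero, g3]
  simp only [Nat.factorial_succ]
  generalize x ^ 2 - x = t
  push_cast
  field_simp
  ring

theorem hasDerivAt_f5 {n : ℕ} (hn : 6 ≤ n) (t : ℝ) :
    HasDerivAt (f5 n)
      (-(t ^ (2 * n - 12) * ((n : ℝ) - 3) * (2 * (n : ℝ) - 11) * (g2 n t * g3 n t))) t := by
  obtain ⟨k, rfl⟩ : ∃ k, n = k + 6 := ⟨n - 6, by omega⟩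
  have e1 : 2 * (k + 6) - 11 = 2 * k + 1 := by omega
  have e2 : 2 * (k + 6) - 12 = 2 * k := by omega
  have hp : ∀ c0 c1 c2 c3 c4 c5 : ℝ, HasDerivAt
      (fun t : ℝ => c5 * t ^ 5 + c4 * t ^ 4 + c3 * t ^ 3 + c2 * t ^ 2 + c1 * t + c0)
      (5 * c5 * t ^ 4 + 4 * c4 * t ^ 3 + 3 * c3 * t ^ 2 + 2 * c2 * t + c1) t :=
    fun c0 c1 c2 c3 c4 c5 => by
      have := ((((((hasDerivAt_pow 5 t).const_mul c5).fun_add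
        ((hasDerivAt_pow 4 t).const_mul c4)).fun_add ((hasDerivAt_pow 3 t).const_mul c3)).fun_add
        ((hasDerivAt_pow 2 t).const_mul c2)).fun_add ((hasDerivAt_id t).const_mul c1)).add_const c0
      refine this.congr_deriv ?_
      norm_num
      ring
  have h1 := (hasDerivAt_pow (2 * k + 1) t).fun_neg.fun_mul
    (hp _ _ _ _ _ _ : HasDerivAt (p5 ((k + 6 : ℕ) : ℝ)) _ t)
  unfold f5
  rw [e1, e2]
  refine h1.congr_deriv ?_
  simp only [g2, g3, Nat.add_sub_cancel]
  push_cast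
  ring

theorem hasDerivAt_f5_comp {n : ℕ} (hn : 6 ≤ n) (a : ℝ) :
    HasDerivAt (fun b : ℝ => f5 n (b ^ 2 - b))
      (-(a ^ 2 - a) ^ (2 * n - 12) * ((n : ℝ) - 3) * (2 * (n : ℝ) - 11) * (2 * a - 1)
        * (g2 n (a ^ 2 - a) * g3 n (a ^ 2 - a))) a := by
  have h1 : HasDerivAt (fun b : ℝ => b ^ 2 - b) (2 * a - 1) a := by
    refine ((hasDerivAt_pow 2 a).fun_sub (hasDerivAt_id a)).congr_deriv ?_
    simp
  refine (HasDerivAt.comp (h := fun b : ℝ => b ^ 2 - b) a (hasDerivAt_f5 hn (a ^ 2 - a))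
    h1).congr_deriv ?_
  ring

/-- Both sides vanish at `a = 0` and have the same derivative on the whole line; the factor `n - 3`
there is the quotient of (k+3)! by (k+2)!. -/
theorem f5_eq_sqDist_mul (k : ℕ) (a : ℝ) :
    f5 (k + 6) (a ^ 2 - a)
      = sqDist k (k + 6) a * (((k + 3).factorial : ℝ) ^ 2 * (2 * (k : ℝ) + 1)) := by
  set c : ℝ := ((k + 3).factorial : ℝ) ^ 2 * (2 * (k : ℝ) + 1) with hc
  have hd : ∀ x, HasDerivAt (fun b : ℝ => f5 (k + 6) (b ^ 2 - b) - sqDist k (k + 6) b * c) 0 x := by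
    intro x
    refine ((hasDerivAt_f5_comp (by omega) x).fun_sub
      ((hasDerivAt_sqDist k (k + 5) x).mul_const c)).congr_deriv ?_
    have h6 : legendreCoeffDeriv k (k + 5 + 1) x = (rodrigues 6 (k + 6)).eval x := by
      rw [legendreCoeffDeriv, primIter_legendre (by omega), show k + 5 + 1 - k = 6 by omega]
    have h5 : legendreCoeffDeriv k (k + 5) x = (rodrigues 5 (k + 5)).eval x := by
      rw [legendreCoeffDeriv, primIter_legendre (by omega)]
      simp
    have hf : ((k + 2).factorial : ℝ) ≠ 0 := by positivity
    rw [h6, h5, eval_rodrigues_five, eval_rodrigues_six, hc,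
      show 2 * (k + 6) - 12 = k + k by omega, pow_add, Nat.factorial_succ (k + 2)]
    push_cast
    field_simp
    ring
  have h := is_const_of_deriv_eq_zero (fun x => (hd x).differentiableAt) (fun x => (hd x).deriv) a 0
  simp only [sqDist_zero] at h
  have h0 : f5 (k + 6) (0 ^ 2 - 0) = 0 := by
    rw [f5, show 2 * (k + 6) - 11 = 2 * k + 1 by omega]
    simp
  rw [h0] at h
  linarith

end ClosedForm

/-! ### Trigonometric roots of the cubic and their location. -/

section Cubic

variable {x : ℝ}

theorem cosPhi_sq (hx : 6 ≤ x) :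
    cosPhi x ^ 2 = (2 * x - 11) ^ 2 * (2 * x - 3) / ((2 * x - 5) ^ 2 * (5 * (x - 3))) := by
  rw [cosPhi, mul_pow, div_pow, div_pow, Real.sq_sqrt (by linarith), Real.sq_sqrt (by linarith),
    div_mul_div_comm]

theorem sinPhi_sq (hx : 6 ≤ x) :
    sinPhi x ^ 2 = (2 * x - 1) ^ 2 * (3 * (x - 4)) / ((2 * x - 5) ^ 2 * (5 * (x - 3))) := by
  rw [sinPhi, mul_pow, div_pow, div_pow, Real.sq_sqrt (by linarith), Real.sq_sqrt (by linarith),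
    div_mul_div_comm]

theorem cosPhi_pos (hx : 6 ≤ x) : 0 < cosPhi x := by
  have h1 : 0 < 2 * x - 11 := by linarith
  have h2 : 0 < 2 * x - 5 := by linarith
  have h3 : 0 < 2 * x - 3 := by linarith
  have h4 : 0 < 5 * (x - 3) := by linarith
  unfold cosPhi
  positivity

theorem sinPhi_pos (hx : 6 ≤ x) : 0 < sinPhi x := by
  have h1 : 0 < 2 * x - 1 := by linarith
  have h2 : 0 < 2 * x - 5 := by linarith
  have h3 : 0 < 3 * (x - 4) := by linarith
  have h4 : 0 < 5 * (x - 3) := by linarith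
  unfold sinPhi
  positivity

theorem sinPhi_sq_eq (hx : 6 ≤ x) : sinPhi x ^ 2 = 1 - cosPhi x ^ 2 := by
  have h2 : 2 * x - 5 ≠ 0 := by linarith
  have h4 : x - 3 ≠ 0 := by linarith
  rw [sinPhi_sq hx, cosPhi_sq hx]
  field_simp
  ring

theorem cosPhi_lt (hx : 6 ≤ x) : cosPhi x < √2 / 2 := by
  refine lt_of_pow_lt_pow_left₀ 2 (by positivity) ?_
  have h2 : 0 < 2 * x - 5 := by linarith
  have h4 : 0 < x - 3 := by linarith
  rw [cosPhi_sq hx, div_pow, Real.sq_sqrt (by norm_num), div_lt_iff₀ (by positivity)]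
  -- In powers of `y` the difference of the two sides has only positive coefficients.
  obtain ⟨y, rfl⟩ : ∃ y, x = y + 6 := ⟨x - 6, by ring⟩
  have hy : 0 ≤ y := by linarith
  have : 0 < y ^ 3 + y ^ 2 + y + 1 := by positivity
  nlinarith [pow_nonneg hy 2, pow_nonneg hy 3]

theorem cos_phi (hx : 6 ≤ x) : Real.cos (phi x) = cosPhi x := by
  refine Real.cos_arccos (by linarith [cosPhi_pos hx]) ?_
  nlinarith [sinPhi_sq_eq hx, sq_nonneg (sinPhi x), cosPhi_pos hx]

theorem sin_phi (hx : 6 ≤ x) : Real.sin (phi x) = sinPhi x := by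
  rw [phi, Real.sin_arccos, ← sinPhi_sq_eq hx, Real.sqrt_sq (sinPhi_pos hx).le]

theorem phi_lt (hx : 6 ≤ x) : phi x < Real.pi / 2 :=
  Real.arccos_lt_pi_div_two.2 (cosPhi_pos hx)

theorem lt_phi (hx : 6 ≤ x) : Real.pi / 4 < phi x := by
  by_contra! h
  have h0 : 0 ≤ phi x := Real.arccos_nonneg _
  have := Real.cos_le_cos_of_nonneg_of_le_pi h0 (by linarith [Real.pi_pos]) h
  rw [cos_phi hx, Real.cos_pi_div_four] at this
  linarith [cosPhi_lt hx]

theorem amp_pos (hx : 6 ≤ x) : 0 < amp x := by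
  have h1 : 0 < 2 * x - 1 := by linarith
  have h3 : 0 < 2 * x - 3 := by linarith
  have h4 : 0 < 5 * (x - 3) := by linarith
  unfold amp
  positivity

theorem amp_sq (hx : 6 ≤ x) : amp x ^ 2 = 5 * (x - 3) / ((2 * x - 1) ^ 2 * (2 * x - 3)) := by
  rw [amp, div_pow, mul_pow, Real.sq_sqrt (by linarith), Real.sq_sqrt (by linarith)]

theorem amp_mul_cosPhi (hx : 6 ≤ x) :
    amp x * cosPhi x = (2 * x - 11) / ((2 * x - 1) * (2 * x - 5)) := by
  have h1 : 2 * x - 1 ≠ 0 := by linarith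
  have h2 : 2 * x - 5 ≠ 0 := by linarith
  have h3 : √(2 * x - 3) ≠ 0 := (Real.sqrt_pos.2 (by linarith)).ne'
  have h4 : √(5 * (x - 3)) ≠ 0 := (Real.sqrt_pos.2 (by linarith)).ne'
  rw [amp, cosPhi]
  generalize √(2 * x - 3) = s at h3
  generalize √(5 * (x - 3)) = r at h4
  field_simp

/-- The depressed form of the cubic `g₃`. -/
theorem g3_shift (hx : 6 ≤ x) (y : ℝ) :
    g3 x (-((x - 3) / (2 * (2 * x - 1))) + amp x * y)
      = 2 * (2 * x - 1) * (2 * x - 3) * (2 * x - 5) * amp x ^ 3 * (4 * y ^ 3 - 3 * y - cosPhi x) := by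
  have h1 : 2 * x - 1 ≠ 0 := by linarith
  have h2 : 2 * x - 5 ≠ 0 := by linarith
  have h3 : 2 * x - 3 ≠ 0 := by linarith
  -- Grouped so that only `amp x ^ 2` and `amp x * cosPhi x` occur beside z = `amp x * y`; both are
  -- rational in `x`.
  have e : 2 * (2 * x - 1) * (2 * x - 3) * (2 * x - 5) * amp x ^ 3 * (4 * y ^ 3 - 3 * y - cosPhi x)
      = 8 * (2 * x - 1) * (2 * x - 3) * (2 * x - 5) * (amp x * y) ^ 3
        - 2 * (2 * x - 1) * (2 * x - 3) * (2 * x - 5) * amp x ^ 2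
          * (3 * (amp x * y) + amp x * cosPhi x) := by ring
  rw [e, amp_mul_cosPhi hx, amp_sq hx, g3]
  generalize amp x * y = z
  field_simp
  ring

theorem cubic_eq_of_roots {a b c d u v w : ℝ} (huv : u ≠ v) (huw : u ≠ w) (hvw : v ≠ w)
    (hu : a * u ^ 3 + b * u ^ 2 + c * u + d = 0) (hv : a * v ^ 3 + b * v ^ 2 + c * v + d = 0)
    (hw : a * w ^ 3 + b * w ^ 2 + c * w + d = 0) (t : ℝ) :
    a * t ^ 3 + b * t ^ 2 + c * t + d = a * (t - u) * (t - v) * (t - w) := by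
  -- Successive divided differences at the three distinct roots.
  have h1 : a * (u ^ 2 + u * v + v ^ 2) + b * (u + v) + c = 0 :=
    mul_left_cancel₀ (sub_ne_zero.2 huv) (by linear_combination hu - hv)
  have h2 : a * (u ^ 2 + u * w + w ^ 2) + b * (u + w) + c = 0 :=
    mul_left_cancel₀ (sub_ne_zero.2 huw) (by linear_combination hu - hw)
  have h3 : a * (u + v + w) + b = 0 :=
    mul_left_cancel₀ (sub_ne_zero.2 hvw) (by linear_combination h1 - h2)
  linear_combination (t ^ 2 - u ^ 2 - (u + v) * (t - u)) * h3 + (t - u) * h1 + hu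

theorem g3_t1 (hx : 6 ≤ x) : g3 x (t1 x) = 0 := by
  have h := g3_shift hx (-Real.cos (phi x / 3 - Real.pi / 3))
  have h3 := Real.cos_three_mul (phi x / 3 - Real.pi / 3)
  rw [show 3 * (phi x / 3 - Real.pi / 3) = phi x - Real.pi by ring, Real.cos_sub_pi,
    cos_phi hx] at h3
  rw [t1, sub_eq_add_neg, ← mul_neg, h, mul_eq_zero]
  right; linear_combination h3

theorem g3_t2 (hx : 6 ≤ x) : g3 x (t2 x) = 0 := by
  have h := g3_shift hx (-Real.cos (phi x / 3 + Real.pi / 3))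
  have h3 := Real.cos_three_mul (phi x / 3 + Real.pi / 3)
  rw [show 3 * (phi x / 3 + Real.pi / 3) = phi x + Real.pi by ring, Real.cos_add_pi,
    cos_phi hx] at h3
  rw [t2, sub_eq_add_neg, ← mul_neg, h, mul_eq_zero]
  right; linear_combination h3

theorem g3_t3 (hx : 6 ≤ x) : g3 x (t3 x) = 0 := by
  have h := g3_shift hx (Real.cos (phi x / 3))
  have h3 := Real.cos_three_mul (phi x / 3)
  rw [show 3 * (phi x / 3) = phi x by ring, cos_phi hx] at h3
  rw [t3, h, mul_eq_zero]
  right; linear_combination -h3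

theorem t1_lt_t2 (hx : 6 ≤ x) : t1 x < t2 x := by
  have hπ := Real.pi_pos
  have h1 := lt_phi hx
  have h2 := phi_lt hx
  have h : Real.cos (phi x / 3 + Real.pi / 3) < Real.cos (phi x / 3 - Real.pi / 3) := by
    rw [← Real.cos_neg (phi x / 3 - Real.pi / 3)]
    exact Real.cos_lt_cos_of_nonneg_of_le_pi (by linarith) (by linarith) (by linarith)
  have := mul_lt_mul_of_pos_left h (amp_pos hx)
  rw [t1, t2]
  linarith

theorem t2_lt_t3 (hx : 6 ≤ x) : t2 x < t3 x := by
  have hπ := Real.pi_pos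
  have h1 := lt_phi hx
  have h2 := phi_lt hx
  have h3 : 0 < Real.cos (phi x / 3 + Real.pi / 3) :=
    Real.cos_pos_of_mem_Ioo ⟨by linarith, by linarith⟩
  have h4 : 0 < Real.cos (phi x / 3) := Real.cos_pos_of_mem_Ioo ⟨by linarith, by linarith⟩
  have h5 := mul_pos (amp_pos hx) h3
  have h6 := mul_pos (amp_pos hx) h4
  rw [t2, t3]
  linarith

theorem g3_eq_mul (hx : 6 ≤ x) (t : ℝ) :
    g3 x t = 8 * (2 * x - 1) * (2 * x - 3) * (2 * x - 5) * (t - t1 x) * (t - t2 x) * (t - t3 x) :=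
  cubic_eq_of_roots (t1_lt_t2 hx).ne ((t1_lt_t2 hx).trans (t2_lt_t3 hx)).ne (t2_lt_t3 hx).ne
    (g3_t1 hx) (g3_t2 hx) (g3_t3 hx) t

theorem g3_leading_pos (hx : 6 ≤ x) : 0 < 8 * (2 * x - 1) * (2 * x - 3) * (2 * x - 5) := by
  have h1 : 0 < 2 * x - 1 := by linarith
  have h2 : 0 < 2 * x - 3 := by linarith
  have h3 : 0 < 2 * x - 5 := by linarith
  positivity

theorem g3_eq_zero_iff (hx : 6 ≤ x) (t : ℝ) :
    g3 x t = 0 ↔ t = t1 x ∨ t = t2 x ∨ t = t3 x := by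
  rw [g3_eq_mul hx, mul_eq_zero, mul_eq_zero, mul_eq_zero, sub_eq_zero, sub_eq_zero, sub_eq_zero,
    or_iff_right (g3_leading_pos hx).ne', or_assoc]

/-- All coefficients of `g3` are positive, so it has no nonnegative root. -/
theorem t3_neg (hx : 6 ≤ x) : t3 x < 0 := by
  by_contra! h
  have h0 := g3_t3 hx
  have h1 : 0 < 2 * x - 1 := by linarith
  have h2 : 0 < 2 * x - 3 := by linarith
  have h3 : 0 < 2 * x - 5 := by linarith
  have h4 : 0 < x - 3 := by linarith
  have h5 : 0 < x - 4 := by linarith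
  have h6 : 0 < x - 5 := by linarith
  have : 0 < g3 x (t3 x) := by unfold g3; positivity
  linarith

theorem neg_quarter_lt_t2 (hx : 6 ≤ x) : -(1 / 4) < t2 x := by
  have hπ := Real.pi_pos
  have h1 := lt_phi hx
  have h2 := phi_lt hx
  have hc : Real.cos (phi x / 3 + Real.pi / 3) < 1 / 2 := by
    rw [← Real.cos_pi_div_three]
    exact Real.cos_lt_cos_of_nonneg_of_le_pi (by linarith) (by linarith) (by linarith)
  have h3 : 0 < 2 * x - 1 := by linarith
  have h4 : 0 < 2 * x - 3 := by linarith
  have ha : amp x < 5 / (2 * (2 * x - 1)) := by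
    refine lt_of_pow_lt_pow_left₀ 2 (by positivity) ?_
    rw [amp_sq hx, div_pow, div_lt_div_iff₀ (by positivity) (by positivity)]
    have : 0 < (2 * x - 1) ^ 2 * (30 * x - 15) := mul_pos (by positivity) (by linarith)
    linarith
  have h5 := mul_lt_mul_of_pos_left hc (amp_pos hx)
  have h6 : (x - 3) / (2 * (2 * x - 1)) = 1 / 4 - 5 / (2 * (2 * x - 1)) * (1 / 2) := by
    have h7 := h3.ne'
    rw [show x - 3 = ((2 * x - 1) - 5) / 2 by ring]
    generalize 2 * x - 1 = w at h7
    field_simp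
    ring
  rw [t2, h6]
  linarith

theorem neg_quarter_lt_t1 (hx : 6 ≤ x) : -(1 / 4) < t1 x := by
  by_contra! h
  have h2 := neg_quarter_lt_t2 hx
  have h3 := t2_lt_t3 hx
  -- The value is -15/8 for every `x`. With t₁ ≤ -1/4 < t₂ < t₃, the factorization would make it
  -- nonnegative.
  have hg : g3 x (-(1 / 4)) < 0 := by
    unfold g3
    nlinarith
  have : 0 ≤ g3 x (-(1 / 4)) := by
    rw [g3_eq_mul hx]
    have e : ∀ L : ℝ, L * (-(1 / 4) - t1 x) * (-(1 / 4) - t2 x) * (-(1 / 4) - t3 x)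
      = L * ((-(1 / 4) - t1 x) * ((t2 x - -(1 / 4)) * (t3 x - -(1 / 4)))) := fun L => by ring
    rw [e]
    exact mul_nonneg (g3_leading_pos hx).le
      (mul_nonneg (by linarith) (mul_nonneg (by linarith) (by linarith)))
  linarith

theorem g3_nonpos_of_le (hx : 6 ≤ x) {t : ℝ} (ht : t ≤ t1 x) : g3 x t ≤ 0 := by
  have h2 := t1_lt_t2 hx
  have h3 := t2_lt_t3 hx
  rw [g3_eq_mul hx]
  have e : ∀ L : ℝ, L * (t - t1 x) * (t - t2 x) * (t - t3 x)
      = -(L * ((t1 x - t) * ((t2 x - t) * (t3 x - t)))) := fun L => by ring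
  rw [e, neg_nonpos]
  exact mul_nonneg (g3_leading_pos hx).le
    (mul_nonneg (by linarith) (mul_nonneg (by linarith) (by linarith)))

theorem g2_nonneg_of_le (hx : 6 ≤ x) {t : ℝ} (ht : t ≤ t1 x) : 0 ≤ g2 x t := by
  have h2 := t1_lt_t2 hx
  have h3 := t2_lt_t3 hx
  have h4 := t3_neg hx
  set L := 8 * (2 * x - 1) * (2 * x - 3) * (2 * x - 5) with hL
  have hd1 : HasDerivAt (g3 x) (3 * L * t ^ 2
      + 24 * (x - 3) * (2 * x - 3) * (2 * x - 5) * t + 6 * (x - 3) * (x - 4) * (2 * x - 5)) t := by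
    have := ((((hasDerivAt_pow 3 t).const_mul L).fun_add ((hasDerivAt_pow 2 t).const_mul
      (12 * (x - 3) * (2 * x - 3) * (2 * x - 5)))).fun_add
      ((hasDerivAt_id t).const_mul (6 * (x - 3) * (x - 4) * (2 * x - 5)))).add_const
      ((x - 3) * (x - 4) * (x - 5))
    refine this.congr_deriv ?_
    norm_num
    ring
  have hd2 : HasDerivAt (g3 x) (L * ((t - t2 x) * (t - t3 x) + (t - t1 x) * (t - t3 x)
      + (t - t1 x) * (t - t2 x))) t := by
    have := ((((hasDerivAt_id t).sub_const (t1 x)).const_mul L).fun_mul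
      ((hasDerivAt_id t).sub_const (t2 x))).fun_mul ((hasDerivAt_id t).sub_const (t3 x))
    rw [show g3 x = _ from funext (g3_eq_mul hx)]
    refine this.congr_deriv ?_
    simp only [id]
    ring
  have he := hd1.unique hd2
  -- The left side is 3g₃ - t g₃'. For a product of factors t - tᵢ this combination replaces one
  -- factor at a time by -tᵢ, which is positive, and left of t₁ the remaining pairs have equal
  -- signs.
  have key : 3 * (x - 3) * g2 x t = L * (-t1 x * ((t2 x - t) * (t3 x - t))
      + -t2 x * ((t1 x - t) * (t3 x - t)) + -t3 x * ((t1 x - t) * (t2 x - t))) := by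
    have hg := g3_eq_mul hx t
    rw [← hL] at hg
    have hg' : 3 * (x - 3) * g2 x t = 3 * g3 x t - t * (3 * L * t ^ 2
      + 24 * (x - 3) * (2 * x - 3) * (2 * x - 5) * t + 6 * (x - 3) * (x - 4) * (2 * x - 5)) := by
      rw [g2, g3, hL]; ring
    rw [hg', he, hg]
    ring
  have hpos : 0 ≤ 3 * (x - 3) * g2 x t := by
    rw [key]
    have a1 : 0 ≤ t1 x - t := by linarith
    have a2 : 0 ≤ t2 x - t := by linarith
    have a3 : 0 ≤ t3 x - t := by linarith
    have b1 : 0 ≤ -t1 x := by linarith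
    have b2 : 0 ≤ -t2 x := by linarith
    have b3 : 0 ≤ -t3 x := by linarith
    have := g3_leading_pos hx
    positivity
  exact nonneg_of_mul_nonneg_right hpos (by linarith)

end Cubic

/-! ### The global maximum of f₅. -/

section Maximum

variable {n : ℕ}

theorem f5_zero (hn : 6 ≤ n) : f5 n 0 = 0 := by
  rw [f5, zero_pow (by omega), neg_zero, zero_mul]

theorem f5_le_of_le_t1 (hn : 6 ≤ n) {t : ℝ} (ht : t ≤ t1 n) : f5 n t ≤ f5 n (t1 n) := by
  have hx : (6 : ℝ) ≤ n := by exact_mod_cast hn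
  have hmono : MonotoneOn (f5 n) (Iic (t1 n)) := by
    refine monotoneOn_of_deriv_nonneg (convex_Iic _)
      (fun s _ => (hasDerivAt_f5 hn s).continuousAt.continuousWithinAt)
      (fun s _ => (hasDerivAt_f5 hn s).differentiableAt.differentiableWithinAt) fun s hs => ?_
    rw [interior_Iic] at hs
    rw [(hasDerivAt_f5 hn s).deriv, Left.nonneg_neg_iff]
    have h1 : 0 ≤ s ^ (2 * n - 12) := Even.pow_nonneg ⟨n - 6, by omega⟩ s
    refine mul_nonpos_of_nonneg_of_nonpos
      (mul_nonneg (mul_nonneg h1 (by linarith)) (by linarith)) ?_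
    exact mul_nonpos_of_nonneg_of_nonpos (g2_nonneg_of_le hx (le_of_lt hs))
      (g3_nonpos_of_le hx (le_of_lt hs))
  exact hmono ht (mem_Iic.2 le_rfl) ht

/-- A Sonin type function: it agrees with `f5 n` at the roots of `g3 n` and is antitone. -/
def sonin (n : ℕ) (t : ℝ) : ℝ :=
  f5 n t - (2 * (n : ℝ) - 11) / 6 * (t ^ (2 * n - 11) * g3 n t ^ 2)

/-- Since 3(n-3)g₂ = 3g₃ - t g₃', the derivative of f₅ contains a g₃g₃' term. The weight (2n-11)/6
is the one that cancels it, leaving a negative multiple of t^(2n-12) g₃². -/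
theorem antitone_sonin (hn : 6 ≤ n) : Antitone (sonin n) := by
  have hx : (6 : ℝ) ≤ n := by exact_mod_cast hn
  obtain ⟨k, rfl⟩ : ∃ k, n = k + 6 := ⟨n - 6, by omega⟩
  have e1 : 2 * (k + 6) - 11 = 2 * k + 1 := by omega
  have e2 : 2 * (k + 6) - 12 = 2 * k := by omega
  have hd : ∀ t, HasDerivAt (sonin (k + 6))
      (-(t ^ (2 * k) * g3 ((k + 6 : ℕ) : ℝ) t ^ 2 * ((2 * (k : ℝ) + 1) + (2 * k + 1) ^ 2 / 6))) t := by
    intro t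
    have hp : ∀ c0 c1 c2 c3 : ℝ, HasDerivAt
        (fun t : ℝ => c3 * t ^ 3 + c2 * t ^ 2 + c1 * t + c0)
        (3 * c3 * t ^ 2 + 2 * c2 * t + c1) t := fun c0 c1 c2 c3 => by
      have := ((((hasDerivAt_pow 3 t).const_mul c3).fun_add
        ((hasDerivAt_pow 2 t).const_mul c2)).fun_add ((hasDerivAt_id t).const_mul c1)).add_const c0
      refine this.congr_deriv ?_
      norm_num
      ring
    have hg : HasDerivAt (g3 ((k + 6 : ℕ) : ℝ)) _ t := hp _ _ _ _
    have h1 := (hasDerivAt_f5 hn t).fun_sub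
      (((hasDerivAt_pow (2 * k + 1) t).fun_mul (hg.fun_pow 2)).const_mul
        ((2 * ((k + 6 : ℕ) : ℝ) - 11) / 6))
    unfold sonin
    rw [e1]
    refine h1.congr_deriv ?_
    rw [e2]
    simp only [g2, g3, Nat.add_sub_cancel]
    push_cast
    ring
  refine antitone_of_deriv_nonpos (fun t => (hd t).differentiableAt) fun t => ?_
  rw [(hd t).deriv, neg_nonpos]
  have h1 : 0 ≤ t ^ (2 * k) := Even.pow_nonneg ⟨k, by omega⟩ t
  positivity

theorem f5_le_f5_t1 (hn : 6 ≤ n) (t : ℝ) : f5 n t ≤ f5 n (t1 n) := by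
  have hx : (6 : ℝ) ≤ n := by exact_mod_cast hn
  rcases le_total t (t1 n) with h | h
  · exact f5_le_of_le_t1 hn h
  have hodd : Odd (2 * n - 11) := ⟨n - 6, by omega⟩
  have hneg : ∀ s, t1 n ≤ s → s ≤ 0 → f5 n s ≤ f5 n (t1 n) := fun s hs hs0 => by
    -- For `s ≤ 0` the odd power is nonpositive, so `sonin` majorizes `f5` at `s`, while the two
    -- agree at `t1`.
    have h1 := antitone_sonin hn hs
    simp only [sonin, g3_t1 hx] at h1
    have h2 : 0 ≤ (2 * (n : ℝ) - 11) / 6 := by linarith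
    have h3 := mul_nonneg h2 (mul_nonneg (neg_nonneg.2 (hodd.pow_nonpos hs0)) (sq_nonneg (g3 n s)))
    nlinarith
  rcases le_total t 0 with h0 | h0
  · exact hneg t h h0
  · have h1 := hneg 0 (((t1_lt_t2 hx).trans (t2_lt_t3 hx)).trans (t3_neg hx)).le le_rfl
    rw [f5_zero hn] at h1
    refine le_trans ?_ h1
    rw [f5, neg_mul, neg_nonpos]
    have a1 : 0 ≤ 2 * (n : ℝ) - 1 := by linarith
    have a2 : 0 ≤ 2 * (n : ℝ) - 3 := by linarith
    have a3 : 0 ≤ 2 * (n : ℝ) - 5 := by linarith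
    have a4 : 0 ≤ 2 * (n : ℝ) - 7 := by linarith
    have a5 : 0 ≤ 2 * (n : ℝ) - 11 := by linarith
    have a6 : 0 ≤ (n : ℝ) - 1 := by linarith
    have a7 : 0 ≤ (n : ℝ) - 2 := by linarith
    have a8 : 0 ≤ (n : ℝ) - 3 := by linarith
    have a9 : 0 ≤ (n : ℝ) - 4 := by linarith
    have : 0 ≤ p5 n t := by unfold p5; positivity
    positivity

theorem f5_t1_eq_maxValue (hn : 6 ≤ n) : f5 n (t1 n) = maxValue n := by
  have hx : (6 : ℝ) ≤ n := by exact_mod_cast hn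
  have h1 : 2 * (n : ℝ) - 1 ≠ 0 := by linarith
  have hs : √(2 * (n : ℝ) - 3) ≠ 0 := (Real.sqrt_pos.2 (by linarith)).ne'
  have hs2 : 2 * (n : ℝ) - 3 = √(2 * (n : ℝ) - 3) ^ 2 := (Real.sq_sqrt (by linarith)).symm
  have hB : bigB n = -2 * t1 n * ((2 * (n : ℝ) - 1) * √(2 * (n : ℝ) - 3)) := by
    rw [bigB, t1, amp]
    field_simp
    ring
  have hodd : Odd (2 * n - 11) := ⟨n - 6, by omega⟩
  simp only [maxValue]
  rw [hB]
  generalize t1 (n : ℝ) = t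
  have hpow : 1 / 2 ^ (2 * n - 11) * (-2 * t * ((2 * (n : ℝ) - 1) * √(2 * (n : ℝ) - 3))
      / ((2 * (n : ℝ) - 1) * √(2 * (n : ℝ) - 3))) ^ (2 * n - 11) = -t ^ (2 * n - 11) := by
    rw [mul_div_assoc, div_self (mul_ne_zero h1 hs), mul_one, show -2 * t = 2 * (-t) by ring,
      mul_pow, hodd.neg_pow]
    field_simp
  rw [hpow, f5]
  congr 1
  rw [p5]
  generalize √(2 * (n : ℝ) - 3) = s at hs hs2
  -- Eliminating `n` in favour of the square root makes the claim a rational identity in `s` and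
  -- `t`.
  have hn' : (n : ℝ) = (s ^ 2 + 3) / 2 := by linarith
  rw [hn'] at h1 ⊢
  have h1' : s ^ 2 + 2 ≠ 0 := by positivity
  have e1 : 2 * ((s ^ 2 + 3) / 2) - 1 = s ^ 2 + 2 := by ring
  have e2 : 2 * ((s ^ 2 + 3) / 2) - 3 = s ^ 2 := by ring
  rw [e1, e2]
  field_simp
  ring

end Maximum

end SobolevEmbedding

end

/-! ### The main theorem. -/

open SobolevEmbedding in
theorem mainTheorem4 (𝕜 : Type*) [RCLike 𝕜] (n : ℕ) (hn : 6 ≤ n) :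
    -- the explicit form of `A²_{n,5}`, with `t = a² - a`
    (∀ a ∈ Set.Icc (0 : ℝ) 1,
      BddAbove (derValues 𝕜 n 5 a) ∧
      A 𝕜 n 5 a ^ 2 =
        -(a ^ 2 - a) ^ (2 * n - 11) / (((n - 3).factorial : ℝ) ^ 2 * (2 * (n : ℝ) - 11))
          * p5 n (a ^ 2 - a)) ∧
    (∀ a ∈ Set.Icc (0 : ℝ) 1,
      f5 n (a ^ 2 - a) =
        A 𝕜 n 5 a ^ 2 * (((n - 3).factorial : ℝ) ^ 2 * (2 * (n : ℝ) - 11))) ∧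
    -- the derivative factors
    (∀ a : ℝ,
      HasDerivAt (fun b : ℝ => f5 n (b ^ 2 - b))
        (-(a ^ 2 - a) ^ (2 * n - 12) * ((n : ℝ) - 3) * (2 * (n : ℝ) - 11) * (2 * a - 1)
          * (g2 n (a ^ 2 - a) * g3 n (a ^ 2 - a))) a) ∧
    -- the angle `φ`
    (Real.cos (phi n) = cosPhi n ∧ Real.sin (phi n) = sinPhi n ∧
      Real.pi / 4 < phi n ∧ phi n < Real.pi / 2) ∧
    -- the roots of the cubic `g₃`
    (-(1 / 4) < t1 n ∧ t1 n < t2 n ∧ t2 n < t3 n ∧ t3 n < 0) ∧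
    (∀ t : ℝ, g3 n t = 0 ↔ t = t1 n ∨ t = t2 n ∨ t = t3 n) ∧
    -- `t₁` is the point of global maximum of `f_{n,5}` and of `A²_{n,5}`
    (∀ t : ℝ, f5 n t ≤ f5 n (t1 n)) ∧
    (∃ a ∈ Set.Ioo (0 : ℝ) 1, a ^ 2 - a = t1 n) ∧
    (∀ a ∈ Set.Icc (0 : ℝ) 1, a ^ 2 - a = t1 n →
      IsMaxOn (fun b : ℝ => A 𝕜 n 5 b ^ 2) (Set.Icc (0 : ℝ) 1) a) ∧
    -- the sharp embedding constant
    BddAbove (A 𝕜 n 5 '' Set.Icc (0 : ℝ) 1) ∧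
    Lam 𝕜 n 5 ^ 2 = f5 n (t1 n) / (((n - 3).factorial : ℝ) ^ 2 * (2 * (n : ℝ) - 11)) ∧
    f5 n (t1 n) = maxValue n := by
  have hx : (6 : ℝ) ≤ n := by exact_mod_cast hn
  set D : ℝ := ((n - 3).factorial : ℝ) ^ 2 * (2 * (n : ℝ) - 11) with hD
  have hDpos : 0 < D := mul_pos (by positivity) (by linarith)
  have hf5 : ∀ a : ℝ, f5 n (a ^ 2 - a) = sqDist (n - 6) n a * D := fun a => by
    obtain ⟨k, rfl⟩ : ∃ k, n = k + 6 := ⟨n - 6, by omega⟩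
    rw [f5_eq_sqDist_mul, hD]
    simp only [Nat.add_sub_cancel, show k + 6 - 3 = k + 3 by omega]
    push_cast
    ring
  have hidx : 5 + (n - 6) + 1 = n := by omega
  have hA : ∀ a ∈ Set.Icc (0 : ℝ) 1, A 𝕜 n 5 a = √(f5 n (a ^ 2 - a) / D) := fun a ha => by
    rw [A_eq_sqrt_sqDist hidx ha, hf5, mul_div_cancel_right₀ _ hDpos.ne']
  have hA2 : ∀ a ∈ Set.Icc (0 : ℝ) 1, A 𝕜 n 5 a ^ 2 = f5 n (a ^ 2 - a) / D := fun a ha => by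
    rw [A_eq_sqrt_sqDist hidx ha, Real.sq_sqrt (sqDist_nonneg ha), hf5,
      mul_div_cancel_right₀ _ hDpos.ne']
  have hmax : ∀ a, f5 n (a ^ 2 - a) / D ≤ f5 n (t1 n) / D := fun a =>
    div_le_div_of_nonneg_right (f5_le_f5_t1 hn _) hDpos.le
  have ht1 := neg_quarter_lt_t1 hx
  have ht1neg : t1 n < 0 := ((t1_lt_t2 hx).trans (t2_lt_t3 hx)).trans (t3_neg hx)
  -- The smaller root of a² - a = t₁; it is real and interior because -1/4 < t₁ < 0.
  obtain ⟨a₀, ha₀, hat⟩ : ∃ a ∈ Set.Ioo (0 : ℝ) 1, a ^ 2 - a = t1 n := by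
    have h0 : 0 < 1 + 4 * t1 n := by linarith
    have h1 := Real.sq_sqrt h0.le
    have h2 : √(1 + 4 * t1 n) < 1 := by rw [Real.sqrt_lt' one_pos]; linarith
    have h3 := Real.sqrt_nonneg (1 + 4 * t1 n)
    exact ⟨(1 - √(1 + 4 * t1 n)) / 2, ⟨by linarith, by linarith⟩, by linear_combination h1 / 4⟩
  have hgreatest : IsGreatest (A 𝕜 n 5 '' Set.Icc (0 : ℝ) 1) (A 𝕜 n 5 a₀) := by
    refine ⟨⟨a₀, Set.Ioo_subset_Icc_self ha₀, rfl⟩, ?_⟩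
    rintro _ ⟨a, ha, rfl⟩
    rw [hA a ha, hA a₀ (Set.Ioo_subset_Icc_self ha₀), hat]
    exact Real.sqrt_le_sqrt (hmax a)
  refine ⟨fun a ha => ⟨(isGreatest_derValues hidx ha).bddAbove, ?_⟩, fun a ha => ?_,
    hasDerivAt_f5_comp hn, ⟨cos_phi hx, sin_phi hx, lt_phi hx, phi_lt hx⟩,
    ⟨ht1, t1_lt_t2 hx, t2_lt_t3 hx, t3_neg hx⟩, g3_eq_zero_iff hx, f5_le_f5_t1 hn,
    ⟨a₀, ha₀, hat⟩, fun a ha hta b hb => ?_, hgreatest.bddAbove, ?_, f5_t1_eq_maxValue hn⟩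
  · rw [hA2 a ha, f5]
    ring
  · rw [hA2 a ha, div_mul_cancel₀ _ hDpos.ne']
  · simp only [Set.mem_ofPred_eq]
    rw [hA2 a ha, hA2 b hb, hta]
    exact hmax b
  · rw [Lam, hgreatest.csSup_eq, hA2 a₀ (Set.Ioo_subset_Icc_self ha₀), hat]
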